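/- For $k\ge 3$ let $\mathcal C_k$ be the circular graph with vertex set $\{1,\dots,k\}$ (vertices understood mod $k$, $j$ adjacent to $j\pm1$). The meteor process on $\mathcal C_k$ is driven by independent rate-$1$ Poisson processes $N^1,\dots,N^k$ on the time-line $\mathbb R$: at each jump time $t$ of $N^j$ the mass $M^j_{t-}\ge 0$ at $j$ is divided equally between the two neighbors of $j$ (added to their masses), $M^j_t=0$, and masses do not change otherwise; the configuration $\mathcal M_s=(M^j_s)_{1\le j\le k}$ is independent of the increments of the Poisson processes after time $s$, and the total mass is $k$. Assume that the process $\{\mathcal M_t,\ t\in\mathbb R\}$ is in the stationary regime, i.e. the law of $\mathcal M_t$ does not depend on $t$. Let $T^j$ be the time of the last jump of $N^j$ on $(-\infty,0]$. The site $j$ is a crater (at time $0$) if $M^j_0=0$, and it is a mound (at time $0$) if $T^{j-1}>T^j<T^{j+1}$. For sites $i,j$ write $|i-j|\in\{0,\dots,k-1\}$ for the number of steps to the right needed to move from $i$ to $j$ around $\mathcal C_k$; a site is between $i$ and $j$ if it is visited strictly between them in this motion. Let $\mathcal G_1$ be the set of pairs $(i,j)$, $i\ne j$, such that $i$ and $j$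 are craters and there are no craters between $i$ and $j$. Let $\mathcal G_2$ be the set of pairs $(i,j)$ such that one of $i,j$ is a crater and the other is a mound, and there are neither craters nor mounds between $i$ and $j$. For $m=1,2$ and $r>2$ let $$A^m_r=\left\{\frac{\max_{(i,j)\in\mathcal G_m}|i-j|}{\min_{(i,j)\in\mathcal G_m}|i-j|}\le r\right\}.$$ (i) Let $H^1_n$ be the event that there are exactly $n$ craters at time $0$. For every integer $n\ge2$, every $p<1$ and every $r>2$ there exists $k_1<\infty$ such that for all $k\ge k_1$, $\mathbb P(H^1_n)>0$ and $\mathbb P(A^1_r\mid H^1_n)>p$. (ii) Let $H^2_n$ be the event that there are exactly $n$ craters and mounds (in total) at time $0$. For every even integer $n\ge2$, every $p<1$ and every $r>2$ there exists $k_1<\infty$ such that for all $k\ge k_1$, $\mathbb P(H^2_n)>0$ and $\mathbb P(A^2_r\mid H^2_n)>p$. -/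

import Mathlib

open MeasureTheory ProbabilityTheory Filter Topology

namespace Meteor

/-- The path `f : ℝ → ℤ` of a counting process (nondecreasing, right-continuous) has a jump
at time `t`, i.e. `f (t-) < f t`. -/
def JumpsAt (f : ℝ → ℤ) (t : ℝ) : Prop :=
  ∀ s < t, f s < f t

/-- Time of the last jump of the path `f` on the interval `(-∞, 0]`. -/
noncomputable def lastJump (f : ℝ → ℤ) : ℝ :=
  sSup {t : ℝ | t ≤ 0 ∧ JumpsAt f t}

/-- A Poisson process of intensity `1` indexed by the whole real time-line, normalized by
`N 0 = 0`. -/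
structure IsPoissonProcess {Ω : Type*} [MeasurableSpace Ω] (μ : Measure Ω)
    (N : ℝ → Ω → ℤ) : Prop where
  measurable : ∀ t, Measurable (N t)
  zero : ∀ᵐ ω ∂μ, N 0 ω = 0
  monotone : ∀ᵐ ω ∂μ, Monotone fun t => N t ω
  rightContinuous : ∀ᵐ ω ∂μ, ∀ t, ContinuousWithinAt (fun s => N s ω) (Set.Ici t) t
  indepIncrements : HasIndepIncrements N μ
  law_increment : ∀ s t, s < t →
    HasLaw (fun ω => N t ω - N s ω)
      ((poissonMeasure (t - s).toNNReal).map (Nat.cast : ℕ → ℤ)) μ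

section Graph

variable {V : Type*} [Fintype V] [DecidableEq V] (G : SimpleGraph V) [DecidableRel G.Adj]

/-- The effect of a meteor hitting the site `v` when the mass configuration is `m`: the mass at
`v` is distributed equally among all neighbors of `v`, and no mass is left at `v`. -/
noncomputable def meteorHit (v : V) (m : V → ℝ) : V → ℝ := fun x =>
  if x = v then 0 else if G.Adj v x then m x + m v / (G.degree v : ℝ) else m x

/-- `M` is a meteor (mass redistribution) process on `G`, indexed by the whole real time-line,
driven by the meteor arrival processes `N v`, `v ∈ V`, and with total mass `|V|`. -/
structure IsMeteorProcess {Ω : Type*} [MeasurableSpace Ω] (μ : Measure Ω)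
    (N : V → ℝ → Ω → ℤ) (M : ℝ → Ω → V → ℝ) : Prop where
  poisson : ∀ v, IsPoissonProcess μ (N v)
  indep : iIndepFun (fun v ω t => N v t ω) μ
  measurable : ∀ t, Measurable (M t)
  nonneg : ∀ᵐ ω ∂μ, ∀ t v, 0 ≤ M t ω v
  total_mass : ∀ᵐ ω ∂μ, ∀ t, ∑ v, M t ω v = Fintype.card V
  /-- The masses do not change in a time interval without meteor hits. -/
  constant : ∀ᵐ ω ∂μ, ∀ s t, s ≤ t → (∀ v, N v s ω = N v t ω) → M s ω = M t ω
  /-- At a jump of `N v`, the configuration just before the jump is redistributed from `v`. -/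
  hit : ∀ᵐ ω ∂μ, ∀ v t, JumpsAt (fun s => N v s ω) t →
    ∃ m : V → ℝ, Tendsto (fun s => M s ω) (𝓝[<] t) (𝓝 m) ∧ M t ω = meteorHit G v m
  /-- The configuration at time `s` is independent of the meteor hits after time `s`. -/
  indep_future : ∀ s, IndepFun (M s)
    (fun ω (v : V) (u : Set.Ici s) => N v (u : ℝ) ω - N v s ω) μ

/-- The meteor process is in the stationary regime: the law of `M t` is the same for all
`t ∈ ℝ`, so this common law is a stationary distribution of the mass process. -/
structure IsStationaryMeteorProcess {Ω : Type*} [MeasurableSpace Ω] (μ : Measure Ω)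
    (N : V → ℝ → Ω → ℤ) (M : ℝ → Ω → V → ℝ) : Prop extends IsMeteorProcess G μ N M where
  stationary : ∀ s t, IdentDistrib (M s) (M t) μ μ

/-- The set of craters (sites with zero mass) of a mass configuration. -/
def craters (m : V → ℝ) : Set V := {v | m v = 0}

/-- The set of mounds: sites whose last meteor hit up to time `0` is earlier than the last
meteor hit up to time `0` at each of the neighboring sites. -/
def mounds (f : V → ℝ → ℤ) : Set V := {v | ∀ x, G.Adj v x → lastJump (f v) < lastJump (f x)}

end Graph

section Circle

variable {k : ℕ}

/-- The number of steps to the right needed to get from `i` to `j` on the circular graph. -/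
def arcLength (i j : Fin k) : ℕ := (j - i).val

/-- `l` lies strictly between `i` and `j`, that is, it is visited strictly between them when
moving to the right from `i` to `j` on the circular graph. -/
def Between (i l j : Fin k) : Prop := 0 < arcLength i l ∧ arcLength i l < arcLength i j

/-- Pairs of adjacent elements of `C` (craters). -/
def adjacentPairs (C : Set (Fin k)) : Set (Fin k × Fin k) :=
  {p | p.1 ≠ p.2 ∧ p.1 ∈ C ∧ p.2 ∈ C ∧ ∀ l, Between p.1 l p.2 → l ∉ C}

/-- Pairs consisting of one element of `C` (a crater) and one element of `D` (a mound), in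
either order, with no elements of `C` or `D` between them. -/
def adjacentMixedPairs (C D : Set (Fin k)) : Set (Fin k × Fin k) :=
  {p | ((p.1 ∈ C ∧ p.2 ∈ D) ∨ (p.1 ∈ D ∧ p.2 ∈ C)) ∧
    ∀ l, Between p.1 l p.2 → l ∉ C ∧ l ∉ D}

/-- The ratio of the maximal distance to the minimal distance over a family of pairs; the
supremum and infimum are over a finite set of natural numbers. -/
noncomputable def gapRatio (P : Set (Fin k × Fin k)) : ℝ :=
  ((sSup ((fun p => arcLength p.1 p.2) '' P) : ℕ) : ℝ) /
    ((sInf ((fun p => arcLength p.1 p.2) '' P) : ℕ) : ℝ)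

variable {Ω : Type*}

/-- The set of craters on the circular graph at time `0`. -/
def cratersAtZero (M : ℝ → Ω → Fin k → ℝ) (ω : Ω) : Set (Fin k) := craters (M 0 ω)

/-- The set of mounds on the circular graph at time `0`. -/
def moundsAtZero (N : Fin k → ℝ → Ω → ℤ) (ω : Ω) : Set (Fin k) :=
  mounds (SimpleGraph.cycleGraph k) fun v t => N v t ω

/-- The event that there are exactly `n` craters at time `0`. -/
def eventH1 (M : ℝ → Ω → Fin k → ℝ) (n : ℕ) : Set Ω := {ω | (cratersAtZero M ω).ncard = n}

/-- The event that there are exactly `n` craters and mounds at time `0`. -/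
def eventH2 (N : Fin k → ℝ → Ω → ℤ) (M : ℝ → Ω → Fin k → ℝ) (n : ℕ) : Set Ω :=
  {ω | (cratersAtZero M ω ∪ moundsAtZero N ω).ncard = n}

/-- The event that the gaps between adjacent craters differ at most by the factor `r`. -/
def eventA1 (M : ℝ → Ω → Fin k → ℝ) (r : ℝ) : Set Ω :=
  {ω | gapRatio (adjacentPairs (cratersAtZero M ω)) ≤ r}

/-- The event that the gaps between adjacent craters and mounds differ at most by the
factor `r`. -/
def eventA2 (N : Fin k → ℝ → Ω → ℤ) (M : ℝ → Ω → Fin k → ℝ) (r : ℝ) : Set Ω :=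
  {ω | gapRatio (adjacentMixedPairs (cratersAtZero M ω) (moundsAtZero N ω)) ≤ r}

end Circle

end Meteor

/-! The state at time 0 is read off the last hit times of the sites. A site hit after both
neighbours is empty. Conversely, if a neighbour `w` was hit after `v`, that hit left mass at `v`
unless `v` and `w` were both empty just before. In the stationary regime this exception does not
occur: hits never create a pair of adjacent empty sites, so stationarity makes the set of such pairs
almost surely constant, yet with positive probability hits at one suitable site destroy a pair
(`ae_zeroPairs_eq_empty`). Hence craters are the local maxima and mounds the local minima of the
last hit times (`ae_craters_mounds`). These times are i.i.d. without atoms, so their ranking is a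
uniform permutation of `Fin k`, and the theorem becomes a count of permutations with `n` peaks.

Cut the circle at the smallest value. A permutation with `n` peaks then splits into `2 * n`
alternately increasing and decreasing runs, and it is recovered from the cut and the map sending
each value to the index of its run (`eq_of_valueRun_eq`). So those with a run noticeably shorter
than `k / (2 * n)` number at most `k` times the functions `Fin k → Fin (2 * n)` with a small fiber,
an exponentially small part of all functions by a Chernoff bound (`exists_card_small_fiber_le`). On
the other hand, fixing `2 * n` extreme values as markers of the runs and distributing the others
freely gives at least `(2 * n) ^ (k - 2 * n)` permutations with `n` peaks
(`card_permsWithPeaks_ge`). Short runs are therefore negligible. Without them, for large `k`, the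
gaps between consecutive extrema differ by a factor at most 2, and so do the gaps between
consecutive peaks, which are sums of two of them. -/

namespace Meteor

/-! ### Paths of counting processes -/

/-- A path of a counting process on the whole time-line: nondecreasing and right-continuous. -/
structure IsCountingPath (f : ℝ → ℤ) : Prop where
  mono : Monotone f
  rightCont : ∀ t, ContinuousWithinAt f (Set.Ici t) t

namespace IsCountingPath

variable {f : ℝ → ℤ}

lemma eventually_eq (hf : IsCountingPath f) (t : ℝ) : ∀ᶠ s in 𝓝[≥] t, f s = f t := by
  have h := hf.rightCont t
  rw [ContinuousWithinAt, nhds_discrete, tendsto_pure] at h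
  exact h

/-- If a counting path is not constant on `[s, t]`, then it reaches the value `f t` at some time
of `(s, t]`. -/
lemma exists_hitting (hf : IsCountingPath f) {s t : ℝ} (h : f s < f t) :
    ∃ u, s < u ∧ u ≤ t ∧ f u = f t ∧ ∀ x < u, f x < f t := by
  set A : Set ℝ := {x | f x = f t} with hA
  have hne : A.Nonempty := ⟨t, rfl⟩
  have hlb : s ∈ lowerBounds A := fun x hx => by
    by_contra hlt
    have := hf.mono (not_le.1 hlt).le
    simp only [hA, Set.mem_ofPred_eq] at hx
    omega
  have hbdd : BddBelow A := ⟨s, hlb⟩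
  have hut : sInf A ≤ t := csInf_le hbdd rfl
  have hu : f (sInf A) = f t := by
    obtain ⟨ε, hε, hball⟩ := Metric.mem_nhdsWithin_iff.1 (hf.eventually_eq (sInf A))
    obtain ⟨x, hxA, hx⟩ := exists_lt_of_csInf_lt hne (lt_add_of_pos_right (sInf A) hε)
    have hx' : sInf A ≤ x := csInf_le hbdd hxA
    have := hball ⟨by rw [Metric.mem_ball, Real.dist_eq, abs_lt]; constructor <;> linarith, hx'⟩
    simp only [Set.mem_ofPred_eq] at this
    rw [← this]
    exact hxA
  refine ⟨sInf A, lt_of_le_of_ne (le_csInf hne hlb) ?_, hut, hu, fun x hx => ?_⟩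
  · intro he
    rw [← he] at hu
    omega
  · refine lt_of_le_of_ne (hf.mono (hx.le.trans hut)) fun he => ?_
    exact absurd (csInf_le hbdd he) (not_le.2 hx)

/-- A counting path is constant in a left neighborhood of `u` (without `u`). -/
lemma exists_left_const (hf : IsCountingPath f) {s u : ℝ} (hsu : s < u) :
    ∃ x, s ≤ x ∧ x < u ∧ ∀ y, x ≤ y → y < u → f y = f x := by
  obtain ⟨z, ⟨x, hx1, hx2, rfl⟩, hz⟩ :=
    Int.exists_greatest_of_bdd (P := fun z => ∃ x, s ≤ x ∧ x < u ∧ f x = z)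
      ⟨f u, by rintro z ⟨x, -, hx, rfl⟩; exact hf.mono hx.le⟩ ⟨f s, s, le_rfl, hsu, rfl⟩
  exact ⟨x, hx1, hx2, fun y hy hyu =>
    le_antisymm (hz _ ⟨y, hx1.trans hy, hyu, rfl⟩) (hf.mono hy)⟩

/-- The last jump of a counting path on `(-∞, 0]`, if there is one. -/
lemma lastJump_spec (hf : IsCountingPath f) {s : ℝ} (h : f s < f 0) :
    lastJump f ≤ 0 ∧ JumpsAt f (lastJump f) ∧ ∀ t ≤ 0, lastJump f ≤ t ↔ f t = f 0 := by
  obtain ⟨u, -, hu0, hfu, hlt⟩ := hf.exists_hitting h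
  have hg : IsGreatest {t : ℝ | t ≤ 0 ∧ JumpsAt f t} u := by
    refine ⟨⟨hu0, fun x hx => hfu ▸ hlt x hx⟩, fun t ht => ?_⟩
    by_contra hut
    have h1 := ht.2 u (not_le.1 hut)
    have h2 := hf.mono ht.1
    omega
  have he : lastJump f = u := hg.csSup_eq
  rw [he]
  refine ⟨hu0, hg.1.2, fun t ht => ⟨fun hut => ?_, fun hft => ?_⟩⟩
  · have := hf.mono hut
    have := hf.mono ht
    omega
  · by_contra hut
    have := hlt t (not_le.1 hut)
    omega

end IsCountingPath

/-- The last jump time on `(-∞, 0]`, expressed by countably many values of the path. -/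
noncomputable def ratLastJump (f : ℝ → ℤ) : ℝ :=
  ⨅ q : {q : ℚ // q ≤ 0}, if f (q.1 : ℝ) = f 0 then (q.1 : ℝ) else 0

/-- Only countably many coordinates enter, so the map is measurable on all of `ℝ → ℤ` and
independence passes through it; `lastJump` quantifies over uncountably many times. -/
lemma measurable_ratLastJump : Measurable ratLastJump := by
  refine Measurable.iInf fun q => Measurable.ite ?_ measurable_const measurable_const
  exact measurableSet_eq_fun (measurable_pi_apply _) (measurable_pi_apply _)

/-- The rationals `q ≤ 0` with `f q = f 0` are exactly those at or after the last jump; the default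
0 is harmless because the last jump is at most 0. -/
lemma IsCountingPath.ratLastJump_eq {f : ℝ → ℤ} (hf : IsCountingPath f) {s : ℝ} (h : f s < f 0) :
    ratLastJump f = lastJump f := by
  obtain ⟨h0, -, hiff⟩ := hf.lastJump_spec h
  have hlow : ∀ q : {q : ℚ // q ≤ 0},
      lastJump f ≤ if f (q.1 : ℝ) = f 0 then (q.1 : ℝ) else 0 := fun q => by
    split_ifs with hq
    · exact (hiff _ (by exact_mod_cast q.2)).2 hq
    · exact h0
  have hbdd : BddBelow (Set.range fun q : {q : ℚ // q ≤ 0} =>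
      if f (q.1 : ℝ) = f 0 then (q.1 : ℝ) else 0) :=
    ⟨lastJump f, by rintro _ ⟨q, rfl⟩; exact hlow q⟩
  have : Nonempty {q : ℚ // q ≤ 0} := ⟨⟨0, le_rfl⟩⟩
  refine le_antisymm ?_ (le_ciInf hlow)
  rcases h0.eq_or_lt with he | hlt
  · refine (ciInf_le hbdd ⟨0, le_rfl⟩).trans ?_
    simp [he]
  · refine le_of_forall_gt_imp_ge_of_dense fun y hy => ?_
    obtain ⟨q, hq1, hq2⟩ := exists_rat_btwn (lt_min hy hlt)
    have hq0 : (q : ℝ) < 0 := hq2.trans_le (min_le_right _ _)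
    refine (ciInf_le hbdd ⟨q, by exact_mod_cast hq0.le⟩).trans ?_
    have : f (q : ℝ) = f 0 := (hiff _ hq0.le).1 hq1.le
    simp only [this, if_true]
    exact hq2.le.trans (min_le_left _ _)

/-! ### Paths of the meteor process -/

section Graph

variable {V : Type*} [Fintype V] [DecidableEq V] (G : SimpleGraph V) [DecidableRel G.Adj]

/-- The deterministic properties of a path of the meteor process. -/
structure IsMeteorPath (N : V → ℝ → ℤ) (M : ℝ → V → ℝ) : Prop where
  counting : ∀ v, IsCountingPath (N v)
  nonneg : ∀ t v, 0 ≤ M t v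
  total_mass : ∀ t, ∑ v, M t v = Fintype.card V
  constant : ∀ s t, s ≤ t → (∀ v, N v s = N v t) → M s = M t
  hit : ∀ v t, JumpsAt (N v) t →
    ∃ m : V → ℝ, Tendsto M (𝓝[<] t) (𝓝 m) ∧ M t = meteorHit G v m

lemma IsMeteorProcess.ae_isMeteorPath {Ω : Type*} [MeasurableSpace Ω] {μ : Measure Ω}
    {N : V → ℝ → Ω → ℤ} {M : ℝ → Ω → V → ℝ} (h : IsMeteorProcess G μ N M) :
    ∀ᵐ ω ∂μ, IsMeteorPath G (fun v t => N v t ω) fun t => M t ω := by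
  have h1 : ∀ᵐ ω ∂μ, ∀ v, IsCountingPath fun t => N v t ω := ae_all_iff.2 fun v => by
    filter_upwards [(h.poisson v).monotone, (h.poisson v).rightContinuous] with ω h2 h3
    exact ⟨h2, h3⟩
  filter_upwards [h1, h.nonneg, h.total_mass, h.constant, h.hit] with ω a b c d e
  exact ⟨a, b, c, d, e⟩

variable {G} {N : V → ℝ → ℤ} {M : ℝ → V → ℝ}

namespace IsMeteorPath

/-- The total hit count reduces continuous time to induction on integers: if it is unchanged, no
single count has changed. -/
lemma counting_sum (h : IsMeteorPath G N M) : IsCountingPath fun t => ∑ v, N v t where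
  mono _ _ hst := Finset.sum_le_sum fun v _ => (h.counting v).mono hst
  rightCont t := by
    have h1 : ∀ v, ∀ᶠ s in 𝓝[≥] t, N v s = N v t := fun v => (h.counting v).eventually_eq t
    rw [ContinuousWithinAt, nhds_discrete, tendsto_pure]
    filter_upwards [eventually_all.2 h1] with s hs
    exact Finset.sum_congr rfl fun v _ => hs v

lemma eq_of_sum_eq (h : IsMeteorPath G N M) {s t : ℝ} (hst : s ≤ t)
    (he : ∑ v, N v s = ∑ v, N v t) (v : V) : N v s = N v t :=
  (Finset.sum_eq_sum_iff_of_le fun v _ => (h.counting v).mono hst).1 he v (Finset.mem_univ v)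

/-- At a jump time `u > s` the configuration is obtained by a hit from the configuration at some
time in `[s, u)`. -/
lemma exists_before (h : IsMeteorPath G N M) {s u : ℝ} (hsu : s < u) {v : V}
    (hv : JumpsAt (N v) u) : ∃ x, s ≤ x ∧ x < u ∧ M u = meteorHit G v (M x) := by
  obtain ⟨x, hsx, hxu, hx⟩ := h.counting_sum.exists_left_const hsu
  obtain ⟨m, hm, hM⟩ := h.hit v u hv
  refine ⟨x, hsx, hxu, ?_⟩
  -- The total count is constant on `[x, u)`, so the left limit in the hit rule is the actual
  -- configuration at `x`.
  have hev : M =ᶠ[𝓝[<] u] fun _ => M x := by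
    filter_upwards [Ico_mem_nhdsLT hxu] with y hy
    exact (h.constant x y hy.1 (h.eq_of_sum_eq hy.1 (hx y hy.1 hy.2).symm)).symm
  rw [hM, tendsto_nhds_unique hm ((tendsto_congr' hev).2 tendsto_const_nhds)]

/-- Take the time `u` at which the total reaches its final value. If no site jumped at `u`, each
count would already have its value at some earlier time, and so would the total at the latest of
these times. Simultaneous jumps do no harm, since the hit rule holds for every jumping site. -/
lemma exists_last_hit (h : IsMeteorPath G N M) {s t : ℝ}
    (hne : ∑ v, N v s < ∑ v, N v t) :
    ∃ x u v, s ≤ x ∧ x < u ∧ u ≤ t ∧ JumpsAt (N v) u ∧ M t = meteorHit G v (M x) ∧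
      ∑ v, N v x < ∑ v, N v t := by
  obtain ⟨u, hsu, hut, hu, hlt⟩ := h.counting_sum.exists_hitting hne
  have hjump : ∃ v, JumpsAt (N v) u := by
    by_contra hno
    simp only [JumpsAt] at hno
    push Not at hno
    choose x hxu hx using hno
    have : Nonempty V := by
      by_contra hV
      rw [not_nonempty_iff] at hV
      simp at hne
    obtain ⟨w, hw⟩ := Finite.exists_max x
    have := hlt (x w) (hxu w)
    rw [← hu] at this
    exact this.not_ge (Finset.sum_le_sum fun v _ => (hx v).trans ((h.counting v).mono (hw v)))
  obtain ⟨v, hv⟩ := hjump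
  obtain ⟨x, hsx, hxu, hM⟩ := h.exists_before hsu hv
  exact ⟨x, u, v, hsx, hxu, hut, hv,
    by rw [← h.constant u t hut (h.eq_of_sum_eq hut hu), hM], hlt x hxu⟩

/-- Induction along the hits in the time interval `(s, t]`. -/
lemma induction_hits (h : IsMeteorPath G N M) {s t : ℝ} (hst : s ≤ t) (P : (V → ℝ) → Prop)
    (h0 : P (M s))
    (hstep : ∀ v m u, s < u → u ≤ t → JumpsAt (N v) u → (∀ x, 0 ≤ m x) → P m →
      P (meteorHit G v m)) : P (M t) := by
  have key : ∀ n : ℕ, ∀ t', s ≤ t' → t' ≤ t → ∑ v, N v t' - ∑ v, N v s ≤ n → P (M t') := by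
    intro n
    induction n with
    | zero =>
      intro t' h1 _ h3
      have h4 := h.counting_sum.mono h1
      rw [← h.constant s t' h1 (h.eq_of_sum_eq h1 (by push_cast at h3; omega))]
      exact h0
    | succ n ih =>
      intro t' h1 h2 h3
      have h4 := h.counting_sum.mono h1
      rcases h4.eq_or_lt with he | hlt
      · rw [← h.constant s t' h1 (h.eq_of_sum_eq h1 he)]
        exact h0
      · obtain ⟨x, u, v, hsx, hxu, hut, hv, hM, hlt'⟩ := h.exists_last_hit hlt
        rw [hM]
        refine hstep v _ u (hsx.trans_lt hxu) (hut.trans h2) hv (h.nonneg x)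
          (ih x hsx (hxu.le.trans (hut.trans h2)) ?_)
        push_cast at h3
        omega
  have h4 := h.counting_sum.mono hst
  exact key (∑ v, N v t - ∑ v, N v s).toNat t hst le_rfl (by omega)

end IsMeteorPath

/-! ### Pairs of adjacent sites without mass -/

variable (G) in
/-- The set of pairs of adjacent sites without mass. -/
def zeroPairs (m : V → ℝ) : Set (V × V) := {p | G.Adj p.1 p.2 ∧ m p.1 = 0 ∧ m p.2 = 0}

lemma le_meteorHit {v x : V} (hx : x ≠ v) {m : V → ℝ} (hm : ∀ x, 0 ≤ m x) :
    m x ≤ meteorHit G v m x := by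
  have := hm v
  simp only [meteorHit, if_neg hx]
  split_ifs
  · have : 0 ≤ m v / (G.degree v : ℝ) := by positivity
    linarith
  · exact le_rfl

lemma meteorHit_nonneg (v : V) {m : V → ℝ} (hm : ∀ x, 0 ≤ m x) (x : V) :
    0 ≤ meteorHit G v m x := by
  by_cases hx : x = v
  · simp [meteorHit, hx]
  · exact (hm x).trans (le_meteorHit hx hm)

lemma meteorHit_self (v : V) (m : V → ℝ) : meteorHit G v m v = 0 := by simp [meteorHit]

lemma meteorHit_adj_eq_zero {v x : V} (hvx : G.Adj v x) {m : V → ℝ} (hm : ∀ x, 0 ≤ m x)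
    (h : meteorHit G v m x = 0) : m v = 0 ∧ m x = 0 := by
  have hd : 0 < (G.degree v : ℝ) := by
    exact_mod_cast (G.degree_pos_iff_exists_adj v).2 ⟨x, hvx⟩
  simp only [meteorHit, if_neg hvx.ne', if_pos hvx] at h
  have h1 := hm v
  have h2 := hm x
  have h3 : 0 ≤ m v / (G.degree v : ℝ) := by positivity
  have h4 : m v / (G.degree v : ℝ) = 0 := by linarith
  rw [div_eq_zero_iff] at h4
  exact ⟨h4.resolve_right hd.ne', by linarith⟩

/-- Only `v` can become empty, and a neighbour of `v` empty after the hit received nothing, so both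
were empty before. -/
lemma zeroPairs_meteorHit_subset (v : V) {m : V → ℝ} (hm : ∀ x, 0 ≤ m x) :
    zeroPairs G (meteorHit G v m) ⊆ zeroPairs G m := by
  rintro ⟨x, y⟩ ⟨hadj, hx, hy⟩
  simp only at hadj hx hy
  refine ⟨hadj, ?_⟩
  have aux : ∀ z, z ≠ v → meteorHit G v m z = 0 → m z = 0 := fun z hz h0 =>
    le_antisymm (h0 ▸ le_meteorHit hz hm) (hm z)
  by_cases hxv : x = v
  · subst hxv
    exact meteorHit_adj_eq_zero hadj hm hy
  by_cases hyv : y = v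
  · subst hyv
    exact (meteorHit_adj_eq_zero hadj.symm hm hx).symm
  · exact ⟨aux x hxv hx, aux y hyv hy⟩

omit [Fintype V] [DecidableEq V] [DecidableRel G.Adj] in
/-- In a connected graph, if there is a pair of adjacent sites without mass and the total mass
is not zero, then such a pair can be found next to a site with positive mass. -/
lemma exists_pos_adj_zeroPair (hG : G.Connected) {m : V → ℝ} (hm : ∃ w, m w ≠ 0)
    (hz : (zeroPairs G m).Nonempty) :
    ∃ v, m v ≠ 0 ∧ ∃ p ∈ zeroPairs G m, G.Adj v p.1 := by
  obtain ⟨w, hw⟩ := hm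
  obtain ⟨⟨x, y⟩, hadj, hx, hy⟩ := hz
  obtain ⟨W⟩ := hG.preconnected x w
  -- Walk from the empty pair towards mass. While the next site is empty, it forms a new pair with
  -- the current one; the first site with mass is adjacent to the current pair.
  induction W generalizing y with
  | nil => exact absurd hx hw
  | @cons x x' w hxx' W ih =>
    by_cases h0 : m x' = 0
    · exact ih hw x hxx'.symm h0 hx
    · exact ⟨x', h0, (x, y), ⟨hadj, hx, hy⟩, hxx'.symm⟩

lemma zeroPairs_meteorHit_ssubset {v : V} {m : V → ℝ} (hm : ∀ x, 0 ≤ m x) (hv : m v ≠ 0)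
    {p : V × V} (hp : p ∈ zeroPairs G m) (hvp : G.Adj v p.1) :
    zeroPairs G (meteorHit G v m) ⊂ zeroPairs G m := by
  refine (Set.ssubset_iff_of_subset (zeroPairs_meteorHit_subset v hm)).2 ⟨p, hp, fun h => ?_⟩
  exact hv (meteorHit_adj_eq_zero hvp hm h.2.1).1

namespace IsMeteorPath

lemma zeroPairs_antitone (h : IsMeteorPath G N M) {s t : ℝ} (hst : s ≤ t) :
    zeroPairs G (M t) ⊆ zeroPairs G (M s) :=
  h.induction_hits hst (fun m => zeroPairs G m ⊆ zeroPairs G (M s)) subset_rfl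
    fun v _ _ _ _ _ hm ih => (zeroPairs_meteorHit_subset v hm).trans ih

/-- If only the site `v` is hit in `(s, t]`, and it is next to a pair of adjacent sites without
mass, then the set of such pairs gets smaller. -/
lemma zeroPairs_ssubset (h : IsMeteorPath G N M) {s t : ℝ} (hst : s ≤ t) {v : V}
    (hv : N v s < N v t) (hw : ∀ w ≠ v, N w s = N w t) (h0 : M s v ≠ 0)
    {p : V × V} (hp : p ∈ zeroPairs G (M s)) (hvp : G.Adj v p.1) :
    zeroPairs G (M t) ⊂ zeroPairs G (M s) := by
  have honly : ∀ w u, s < u → u ≤ t → JumpsAt (N w) u → w = v := fun w u h1 h2 h3 => by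
    by_contra hne
    have h4 := h3 s h1
    have h5 := (h.counting w).mono h2
    have h6 := hw w hne
    omega
  have hsum : ∑ v, N v s < ∑ v, N v t :=
    Finset.sum_lt_sum (fun w _ => (h.counting w).mono hst) ⟨v, Finset.mem_univ v, hv⟩
  obtain ⟨x, u, w, hsx, hxu, hut, hwu, hM, -⟩ := h.exists_last_hit hsum
  obtain rfl := honly w u (hsx.trans_lt hxu) hut hwu
  -- The site `v` may be hit several times, but only the first hit is known to find mass there;
  -- hence the disjunctive invariant.
  have hx : M x = M s ∨ zeroPairs G (M x) ⊂ zeroPairs G (M s) := by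
    refine h.induction_hits hsx (fun m => m = M s ∨ zeroPairs G m ⊂ zeroPairs G (M s))
      (Or.inl rfl) fun v' m u' h1 h2 h3 hm ih => Or.inr ?_
    obtain rfl := honly v' u' h1 (h2.trans (hxu.le.trans hut)) h3
    rcases ih with rfl | ih
    · exact zeroPairs_meteorHit_ssubset hm h0 hp hvp
    · exact (zeroPairs_meteorHit_subset _ hm).trans_ssubset ih
  rw [hM]
  rcases hx with hx | hx
  · rw [hx]
    exact zeroPairs_meteorHit_ssubset (h.nonneg s) h0 hp hvp
  · exact (zeroPairs_meteorHit_subset _ (h.nonneg x)).trans_ssubset hx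

/-- A site that has been hit after all its neighbors is a crater. -/
lemma mass_eq_zero (h : IsMeteorPath G N M) {s t : ℝ} (hst : s ≤ t) {v : V}
    (hv : JumpsAt (N v) s) (hadj : ∀ w, w = v ∨ G.Adj v w → N w s = N w t) : M t v = 0 := by
  refine h.induction_hits hst (fun m => m v = 0) ?_ fun w m u h1 h2 h3 _ ih => ?_
  · obtain ⟨m, -, hM⟩ := h.hit v s hv
    simp only [hM, meteorHit_self]
  · have hw : ¬ (w = v ∨ G.Adj v w) := fun hw => by
      have h4 := h3 s h1
      have h5 := (h.counting w).mono h2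
      have h6 := hadj w hw
      omega
    push Not at hw
    simp only [meteorHit, if_neg hw.1.symm, if_neg fun h : G.Adj w v => hw.2 h.symm, ih]

/-- A site with a neighbor that has been hit since the last hit of the site is not a crater, if
there were no pairs of adjacent sites without mass in the past. -/
lemma mass_ne_zero (h : IsMeteorPath G N M) {s t : ℝ} (hst : s ≤ t) {v w : V}
    (hw : JumpsAt (N w) s) (hvw : G.Adj v w) (hv : N v s = N v t)
    (hz : ∃ x < s, zeroPairs G (M x) = ∅) : M t v ≠ 0 := by
  suffices 0 < M t v from this.ne'
  refine h.induction_hits hst (fun m => 0 < m v) ?_ fun x m u h1 h2 h3 hm ih => ?_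
  · obtain ⟨x, hxs, hx⟩ := hz
    obtain ⟨y, hxy, hys, hM⟩ := h.exists_before hxs hw
    rw [hM]
    refine lt_of_le_of_ne (meteorHit_nonneg w (h.nonneg y) v) fun h0 => ?_
    have h1 := meteorHit_adj_eq_zero hvw.symm (h.nonneg y) h0.symm
    have h2 : (v, w) ∈ zeroPairs G (M y) := ⟨hvw, h1.2, h1.1⟩
    have h3 := h.zeroPairs_antitone hxy h2
    rw [hx] at h3
    exact h3
  · have hxv : v ≠ x := fun hxv => by
      subst hxv
      have h4 := h3 s h1
      have h5 := (h.counting v).mono h2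
      omega
    exact ih.trans_le (le_meteorHit hxv hm)

/-- The craters are the sites whose last hit is later than the last hits of the neighbors. -/
lemma craters_eq (h : IsMeteorPath G N M) (hpast : ∀ v, ∃ s, N v s < N v 0)
    (hz : ∀ s, ∃ x < s, zeroPairs G (M x) = ∅)
    (hinj : Function.Injective fun v => lastJump (N v)) :
    craters (M 0) = {v | ∀ x, G.Adj v x → lastJump (N x) < lastJump (N v)} := by
  have hspec := fun v => (h.counting v).lastJump_spec (hpast v).choose_spec
  ext v
  simp only [craters, Set.mem_ofPred_eq]
  constructor
  · intro h0 x hvx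
    by_contra hlt
    have hlt' : lastJump (N v) < lastJump (N x) :=
      lt_of_le_of_ne (not_lt.1 hlt) fun he => hvx.ne (hinj he)
    exact h.mass_ne_zero (hspec x).1 (hspec x).2.1 hvx
      (((hspec v).2.2 _ (hspec x).1).1 hlt'.le) (hz _) h0
  · intro hv
    refine h.mass_eq_zero (hspec v).1 (hspec v).2.1 fun w hw => ?_
    rcases hw with rfl | hw
    · exact ((hspec _).2.2 _ (hspec _).1).1 le_rfl
    · exact ((hspec w).2.2 _ (hspec v).1).1 (hv w hw).le

end IsMeteorPath

end Graph

/-! ### The order of independent identically distributed random variables -/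

section Order

variable {Ω : Type*} [MeasurableSpace Ω] {μ : Measure Ω} [IsProbabilityMeasure μ]

/-- Fubini: every section of the diagonal is a point, which is null for the law of `Y`. -/
lemma ae_ne_of_indepFun {X Y : Ω → ℝ} (hX : Measurable X) (hY : Measurable Y)
    (h : IndepFun X Y μ) (hatom : ∀ a, μ (Y ⁻¹' {a}) = 0) : ∀ᵐ ω ∂μ, X ω ≠ Y ω := by
  have : IsProbabilityMeasure (μ.map X) := Measure.isProbabilityMeasure_map hX.aemeasurable
  have : IsProbabilityMeasure (μ.map Y) := Measure.isProbabilityMeasure_map hY.aemeasurable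
  have hD : MeasurableSet {p : ℝ × ℝ | p.1 = p.2} :=
    measurableSet_eq_fun measurable_fst measurable_snd
  have h1 := (indepFun_iff_map_prod_eq_prod_map_map hX.aemeasurable hY.aemeasurable).1 h
  have h2 : (μ.map fun ω => (X ω, Y ω)) {p : ℝ × ℝ | p.1 = p.2} = 0 := by
    rw [h1, Measure.measure_prod_null hD]
    refine Eventually.of_forall fun a => ?_
    have : Prod.mk a ⁻¹' {p : ℝ × ℝ | p.1 = p.2} = {a} := by
      ext b
      simp [eq_comm]
    change μ.map Y (Prod.mk a ⁻¹' {p : ℝ × ℝ | p.1 = p.2}) = 0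
    rw [this, Measure.map_apply hY (measurableSet_singleton a), hatom]
  rw [Measure.map_apply (hX.prodMk hY) hD] at h2
  rw [ae_iff]
  convert h2 using 2
  ext ω
  simp

/-- The event that the random variables `X i` are ordered like the values of `σ`. -/
def orderEvent {k : ℕ} (X : Fin k → Ω → ℝ) (σ : Equiv.Perm (Fin k)) : Set Ω :=
  {ω | ∀ i j, X i ω < X j ω ↔ σ i < σ j}

variable {k : ℕ} {X : Fin k → Ω → ℝ}

lemma measurableSet_orderEvent (hX : ∀ i, Measurable (X i)) (σ : Equiv.Perm (Fin k)) :
    MeasurableSet (orderEvent X σ) := by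
  have : orderEvent X σ = ⋂ i, ⋂ j, {ω | X i ω < X j ω ↔ σ i < σ j} := by
    ext ω
    simp [orderEvent]
  rw [this]
  refine MeasurableSet.iInter fun i => MeasurableSet.iInter fun j => ?_
  have hm := measurableSet_lt (hX i) (hX j)
  by_cases h : σ i < σ j
  · simpa [h] using hm
  · simpa [h] using measurableSet_le (hX j) (hX i)

omit [MeasurableSpace Ω] in
-- On a common outcome, `τ ∘ σ⁻¹` would be an order automorphism of `Fin k`, hence the identity.
lemma disjoint_orderEvent {σ τ : Equiv.Perm (Fin k)} (h : σ ≠ τ) :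
    Disjoint (orderEvent X σ) (orderEvent X τ) := by
  rw [Set.disjoint_left]
  intro ω h1 h2
  apply h
  have hmono : ∀ i j, (σ.symm.trans τ) i < (σ.symm.trans τ) j ↔ i < j := fun i j => by
    simp only [Equiv.trans_apply]
    rw [← h2, h1]
    simp
  let e : Fin k ≃o Fin k :=
    { σ.symm.trans τ with
      map_rel_iff' := fun {i j} => by
        rw [← not_lt, ← not_lt]
        exact not_congr (hmono j i) }
  have he : e = OrderIso.refl _ := Subsingleton.elim _ _
  ext i
  have h3 : e (σ i) = σ i := by rw [he, OrderIso.refl_apply]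
  have h4 : e (σ i) = τ i := congrArg τ (σ.symm_apply_apply i)
  rw [← h3, h4]

omit [MeasurableSpace Ω] in
lemma exists_mem_orderEvent {ω : Ω} (h : Function.Injective fun i => X i ω) :
    ∃ σ, ω ∈ orderEvent X σ := by
  have h1 := (Tuple.monotone_sort fun i => X i ω).strictMono_of_injective
    (h.comp (Tuple.sort fun i => X i ω).injective)
  refine ⟨(Tuple.sort fun i => X i ω).symm, fun i j => ?_⟩
  rw [← h1.lt_iff_lt]
  simp

/-- The event says that `X ∘ σ⁻¹` is increasing, and the law of an i.i.d. vector is invariant under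
permuting its coordinates. -/
lemma measure_orderEvent_eq (hX : ∀ i, Measurable (X i)) (hind : iIndepFun X μ)
    (hlaw : ∀ i j, μ.map (X i) = μ.map (X j)) (σ : Equiv.Perm (Fin k)) :
    μ (orderEvent X σ) = μ (orderEvent X 1) := by
  have hB : ∀ τ : Equiv.Perm (Fin k), orderEvent X τ =
      (fun ω i => X (τ.symm i) ω) ⁻¹' {x : Fin k → ℝ | ∀ i j, x i < x j ↔ i < j} := fun τ => by
    ext ω
    refine ⟨fun h i j => by simpa using h (τ.symm i) (τ.symm j), fun h i j => ?_⟩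
    simpa using h (τ i) (τ j)
  have hBm : MeasurableSet {x : Fin k → ℝ | ∀ i j, x i < x j ↔ i < j} :=
    measurableSet_orderEvent (X := fun i (x : Fin k → ℝ) => x i)
      (fun i => measurable_pi_apply i) 1
  have hmap : ∀ τ : Equiv.Perm (Fin k), μ.map (fun ω i => X (τ.symm i) ω) =
      Measure.pi fun i => μ.map (X (τ.symm i)) := fun τ =>
    (iIndepFun_iff_map_fun_eq_pi_map fun i => (hX _).aemeasurable).1
      (hind.precomp τ.symm.injective)
  have hmeas : ∀ τ : Equiv.Perm (Fin k), Measurable fun ω i => X (τ.symm i) ω := fun τ =>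
    measurable_pi_lambda _ fun i => hX _
  have hpi : (fun i => μ.map (X (σ.symm i))) =
      fun i => μ.map (X ((1 : Equiv.Perm (Fin k)).symm i)) := funext fun i => hlaw _ _
  rw [hB σ, hB 1, ← Measure.map_apply (hmeas σ) hBm, ← Measure.map_apply (hmeas 1) hBm,
    hmap, hmap, hpi]

lemma measure_orderEvent_ne_zero (hX : ∀ i, Measurable (X i)) (hind : iIndepFun X μ)
    (hlaw : ∀ i j, μ.map (X i) = μ.map (X j))
    (hinj : ∀ᵐ ω ∂μ, Function.Injective fun i => X i ω) : μ (orderEvent X 1) ≠ 0 := by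
  intro h0
  have h1 : μ (⋃ σ, orderEvent X σ) = 0 :=
    measure_iUnion_null fun σ => by rw [measure_orderEvent_eq hX hind hlaw, h0]
  have h2 : ∀ᵐ ω ∂μ, ω ∈ ⋃ σ, orderEvent X σ := by
    filter_upwards [hinj] with ω hω
    exact Set.mem_iUnion.2 (exists_mem_orderEvent hω)
  obtain ⟨ω, a, b⟩ := (h2.and (measure_eq_zero_iff_ae_notMem.1 h1)).exists
  exact b a

end Order

/-! ### Jump times of Poisson processes -/

namespace IsPoissonProcess

variable {Ω : Type*} [MeasurableSpace Ω] {μ : Measure Ω} {N : ℝ → Ω → ℤ}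

lemma measure_increment_zero (h : IsPoissonProcess μ N) {s t : ℝ} (hst : s < t) :
    μ {ω | N t ω - N s ω = 0} = ENNReal.ofReal (Real.exp (s - t)) := by
  have h1 := h.law_increment s t hst
  have h2 : {ω | N t ω - N s ω = 0} = (fun ω => N t ω - N s ω) ⁻¹' {0} := rfl
  rw [h2, ← Measure.map_apply_of_aemeasurable h1.aemeasurable (measurableSet_singleton 0),
    h1.map_eq, Measure.map_apply (by fun_prop) (measurableSet_singleton 0)]
  have h3 : (Nat.cast : ℕ → ℤ) ⁻¹' {0} = {0} := by
    ext n
    simp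
  rw [h3, poissonMeasure_singleton, Real.coe_toNNReal _ (by linarith)]
  simp

lemma ae_isCountingPath (h : IsPoissonProcess μ N) : ∀ᵐ ω ∂μ, IsCountingPath fun t => N t ω := by
  filter_upwards [h.monotone, h.rightContinuous] with ω h1 h2
  exact ⟨h1, h2⟩

/-- A path without jumps on `(-(n + 1), 0]` has probability `exp (-(n + 1))`, which tends to 0. -/
lemma ae_exists_past (h : IsPoissonProcess μ N) : ∀ᵐ ω ∂μ, ∃ s < 0, N s ω < N 0 ω := by
  have h1 : μ {ω | ∀ n : ℕ, N 0 ω - N (-(n + 1)) ω = 0} = 0 := by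
    have h2 : ∀ n : ℕ, μ {ω | ∀ n : ℕ, N 0 ω - N (-(n + 1)) ω = 0} ≤
        ENNReal.ofReal (Real.exp (-(n + 1))) := fun n => by
      have hsub : {ω | ∀ n : ℕ, N 0 ω - N (-(n + 1)) ω = 0} ⊆
          {ω | N 0 ω - N (-(n + 1)) ω = 0} := fun ω hω => hω n
      refine (measure_mono hsub).trans_eq ?_
      rw [h.measure_increment_zero (by linarith [n.cast_nonneg (α := ℝ)]), sub_zero]
    have h3 : Tendsto (fun n : ℕ => ENNReal.ofReal (Real.exp (-(n + 1)))) atTop (𝓝 0) := by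
      rw [← ENNReal.ofReal_zero]
      refine ENNReal.tendsto_ofReal (Real.tendsto_exp_neg_atTop_nhds_zero.comp ?_)
      exact tendsto_atTop_add_const_right _ _ tendsto_natCast_atTop_atTop
    exact le_antisymm (ge_of_tendsto' h3 h2) zero_le
  filter_upwards [measure_eq_zero_iff_ae_notMem.1 h1, h.monotone] with ω h2 h3
  simp only [not_forall] at h2
  obtain ⟨n, hn⟩ := h2
  have hneg : -((n : ℝ) + 1) < 0 := by linarith [n.cast_nonneg (α := ℝ)]
  have := h3 hneg.le
  simp only at this
  exact ⟨_, hneg, by omega⟩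

lemma measurable_ratLastJump (h : IsPoissonProcess μ N) :
    Measurable fun ω => ratLastJump fun t => N t ω :=
  Meteor.measurable_ratLastJump.comp (measurable_pi_lambda _ h.measurable)

lemma ae_ratLastJump (h : IsPoissonProcess μ N) :
    ∀ᵐ ω ∂μ, ratLastJump (fun t => N t ω) = lastJump (fun t => N t ω) ∧
      lastJump (fun t => N t ω) ≤ 0 ∧
      ∀ t ≤ 0, lastJump (fun t => N t ω) ≤ t ↔ N 0 ω - N t ω = 0 := by
  filter_upwards [h.ae_isCountingPath, h.ae_exists_past] with ω h1 h2
  obtain ⟨s, -, hs⟩ := h2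
  have h3 := h1.lastJump_spec hs
  refine ⟨h1.ratLastJump_eq hs, h3.1, fun t ht => (h3.2.2 t ht).trans ?_⟩
  rw [sub_eq_zero, eq_comm]

lemma measure_ratLastJump_le [IsProbabilityMeasure μ] (h : IsPoissonProcess μ N) (a : ℝ) :
    μ {ω | ratLastJump (fun t => N t ω) ≤ a} = ENNReal.ofReal (Real.exp (min a 0)) := by
  rcases lt_or_ge a 0 with ha | ha
  · rw [min_eq_left ha.le, ← sub_zero a, ← h.measure_increment_zero ha, sub_zero]
    refine measure_congr ?_
    filter_upwards [h.ae_ratLastJump] with ω hω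
    exact propext (by
      change ratLastJump (fun t => N t ω) ≤ a ↔ N 0 ω - N a ω = 0
      rw [hω.1, hω.2.2 a ha.le])
  · rw [min_eq_right ha, Real.exp_zero, ENNReal.ofReal_one, ← measure_univ (μ := μ)]
    refine measure_congr (eventuallyEq_univ.2 ?_)
    filter_upwards [h.ae_ratLastJump] with ω hω
    exact hω.1.trans_le (hω.2.1.trans ha)

/-- There are no atoms because the distribution function `exp (min a 0)` is continuous. -/
lemma measure_ratLastJump_eq [IsProbabilityMeasure μ] (h : IsPoissonProcess μ N) (a : ℝ) :
    μ ((fun ω => ratLastJump fun t => N t ω) ⁻¹' {a}) = 0 := by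
  set T : Ω → ℝ := fun ω => ratLastJump fun t => N t ω with hT
  have hle : ∀ b, μ {ω | T ω ≤ b} = ENNReal.ofReal (Real.exp (min b 0)) :=
    h.measure_ratLastJump_le
  have h1 : ∀ b < a, μ (T ⁻¹' {a}) ≤
      ENNReal.ofReal (Real.exp (min a 0) - Real.exp (min b 0)) := fun b hb => by
    have hsub : {ω | T ω ≤ b} ⊆ {ω | T ω ≤ a} := fun ω hω => le_trans hω hb.le
    rw [ENNReal.ofReal_sub _ (Real.exp_pos _).le, ← hle, ← hle,
      ← measure_sdiff hsub (measurableSet_le h.measurable_ratLastJump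
        measurable_const).nullMeasurableSet (measure_ne_top μ _)]
    refine measure_mono fun ω hω => ?_
    have hω : T ω = a := hω
    exact ⟨hω.le, fun hb' => absurd (hω ▸ hb' : a ≤ b) (not_le.2 hb)⟩
  have h2 : Tendsto (fun b => ENNReal.ofReal (Real.exp (min a 0) - Real.exp (min b 0)))
      (𝓝[<] a) (𝓝 0) := by
    have hc : Continuous fun b : ℝ =>
        ENNReal.ofReal (Real.exp (min a 0) - Real.exp (min b 0)) :=
      ENNReal.continuous_ofReal.comp (by fun_prop)
    have := (hc.tendsto a).mono_left (nhdsWithin_le_nhds (s := Set.Iio a))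
    simpa using this
  refine le_antisymm (ge_of_tendsto h2 ?_) zero_le
  filter_upwards [self_mem_nhdsWithin] with b hb using h1 b hb

end IsPoissonProcess

/-! ### Absence of adjacent craters in the stationary regime -/

section Graph

variable {V : Type*} [Fintype V] [DecidableEq V] {G : SimpleGraph V} [DecidableRel G.Adj]
  {Ω : Type*} [MeasurableSpace Ω] {μ : Measure Ω} [IsProbabilityMeasure μ]
  {N : V → ℝ → Ω → ℤ} {M : ℝ → Ω → V → ℝ}

/-- By independence the probability is a product of factors `exp (-1)` and one factor `1 - exp
(-1)`. -/
lemma IsMeteorProcess.measure_single_hit_ne_zero (h : IsMeteorProcess G μ N M) (s : ℝ) (v : V) :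
    μ {ω | ∀ w, (N w (s + 1) ω - N w s ω = 0 ↔ w ≠ v)} ≠ 0 := by
  have hind := h.indep.comp (fun _ (f : ℝ → ℤ) => f (s + 1) - f s)
    (fun _ => (measurable_pi_apply _).sub (measurable_pi_apply _))
  have h1 := hind.measure_inter_preimage_eq_mul Finset.univ
    (sets := fun w => {z : ℤ | z = 0 ↔ w ≠ v}) (fun w _ => MeasurableSet.of_discrete)
  have hset : {ω | ∀ w, (N w (s + 1) ω - N w s ω = 0 ↔ w ≠ v)} =
      ⋂ w ∈ Finset.univ, ((fun f : ℝ → ℤ => f (s + 1) - f s) ∘ fun ω t => N w t ω) ⁻¹'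
        {z : ℤ | z = 0 ↔ w ≠ v} := by
    ext ω
    simp
  rw [hset, h1, Finset.prod_ne_zero_iff]
  intro w _
  have hexp : μ {ω | N w (s + 1) ω - N w s ω = 0} = ENNReal.ofReal (Real.exp (-1)) := by
    rw [(h.poisson w).measure_increment_zero (by linarith)]
    congr 2
    ring
  by_cases hw : w = v
  · have hc : ((fun f : ℝ → ℤ => f (s + 1) - f s) ∘ fun ω t => N w t ω) ⁻¹'
        {z : ℤ | z = 0 ↔ w ≠ v} = {ω | N w (s + 1) ω - N w s ω = 0}ᶜ := by
      ext ω
      simp [hw]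
    have hm : MeasurableSet {ω | N w (s + 1) ω - N w s ω = 0} :=
      (((h.poisson w).measurable _).sub ((h.poisson w).measurable _)) (measurableSet_singleton 0)
    rw [hc, prob_compl_eq_one_sub hm, hexp, Ne, tsub_eq_zero_iff_le, not_le,
      ENNReal.ofReal_lt_one, Real.exp_lt_one_iff]
    norm_num
  · have hc : ((fun f : ℝ → ℤ => f (s + 1) - f s) ∘ fun ω t => N w t ω) ⁻¹'
        {z : ℤ | z = 0 ↔ w ≠ v} = {ω | N w (s + 1) ω - N w s ω = 0} := by
      ext ω
      simp [hw]
    rw [hc, hexp]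
    exact (ENNReal.ofReal_pos.2 (Real.exp_pos _)).ne'

/-- For each pair the later event is contained in the earlier one and has the same probability, so
the two agree almost surely. -/
lemma IsStationaryMeteorProcess.ae_zeroPairs_eq (h : IsStationaryMeteorProcess G μ N M)
    {s t : ℝ} (hst : s ≤ t) : ∀ᵐ ω ∂μ, zeroPairs G (M t ω) = zeroPairs G (M s ω) := by
  have hB : ∀ p : V × V, MeasurableSet {m : V → ℝ | p ∈ zeroPairs G m} := fun p => by
    refine (MeasurableSet.const _).inter (MeasurableSet.inter ?_ ?_) <;>
    exact measurableSet_eq_fun (measurable_pi_apply _) measurable_const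
  have h1 : ∀ p : V × V, ∀ᵐ ω ∂μ, p ∈ zeroPairs G (M s ω) → p ∈ zeroPairs G (M t ω) := by
    intro p
    have h2 : (M t ⁻¹' {m : V → ℝ | p ∈ zeroPairs G m} : Set Ω) ≤ᵐ[μ]
        (M s ⁻¹' {m : V → ℝ | p ∈ zeroPairs G m} : Set Ω) := by
      filter_upwards [h.ae_isMeteorPath] with ω hω
      exact fun hp => hω.zeroPairs_antitone hst hp
    have h3 := (h.stationary t s).measure_mem_eq (hB p)
    have h4 := ae_eq_of_ae_subset_of_measure_ge h2 h3.ge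
      (h.measurable t (hB p)).nullMeasurableSet (measure_ne_top _ _)
    filter_upwards [h4] with ω hω
    exact fun hp => (iff_of_eq hω).2 hp
  filter_upwards [ae_all_iff.2 h1, h.ae_isMeteorPath] with ω h2 h3
  exact (h3.zeroPairs_antitone hst).antisymm fun p => h2 p

/-- In the stationary regime there are no two adjacent craters. -/
lemma IsStationaryMeteorProcess.ae_zeroPairs_eq_empty (hG : G.Connected)
    (h : IsStationaryMeteorProcess G μ N M) (s : ℝ) :
    ∀ᵐ ω ∂μ, zeroPairs G (M s ω) = ∅ := by
  -- The state event `B` at time `s` is independent of the event `F` that only `v` is hit during the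
  -- next unit of time. On `B ∩ F` a pair is lost, against almost sure constancy, so `B ∩ F` is
  -- null; as `F` is not, `B` is.
  have h1 : ∀ v : V, ∀ p : V × V, G.Adj v p.1 →
      ∀ᵐ ω ∂μ, ¬ (M s ω v ≠ 0 ∧ p ∈ zeroPairs G (M s ω)) := by
    intro v p hvp
    set B : Set (V → ℝ) := {m | m v ≠ 0 ∧ p ∈ zeroPairs G m} with hBdef
    have hB : MeasurableSet B := by
      refine MeasurableSet.inter (measurableSet_eq_fun (measurable_pi_apply _)
        measurable_const).compl ((MeasurableSet.const _).inter (MeasurableSet.inter ?_ ?_)) <;>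
      exact measurableSet_eq_fun (measurable_pi_apply _) measurable_const
    let u0 : Set.Ici s := ⟨s + 1, by simp⟩
    set F : Set (V → Set.Ici s → ℤ) := {f | ∀ w, (f w u0 = 0 ↔ w ≠ v)} with hFdef
    have hF : MeasurableSet F := by
      have : F = ⋂ w, (fun f : V → Set.Ici s → ℤ => f w u0) ⁻¹' {z : ℤ | z = 0 ↔ w ≠ v} := by
        ext f
        simp [hFdef]
      rw [this]
      exact MeasurableSet.iInter fun w =>
        ((measurable_pi_apply u0).comp (measurable_pi_apply w)) MeasurableSet.of_discrete
    have hmul := (h.indep_future s).measure_inter_preimage_eq_mul B F hB hF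
    have hFpos : μ ((fun ω (v : V) (u : Set.Ici s) => N v (u : ℝ) ω - N v s ω) ⁻¹' F) ≠ 0 :=
      h.measure_single_hit_ne_zero s v
    have hnull : μ (M s ⁻¹' B ∩
        (fun ω (v : V) (u : Set.Ici s) => N v (u : ℝ) ω - N v s ω) ⁻¹' F) = 0 := by
      rw [measure_eq_zero_iff_ae_notMem]
      filter_upwards [h.ae_isMeteorPath, h.ae_zeroPairs_eq (le_add_of_nonneg_right zero_le_one :
        s ≤ s + 1)] with ω hpath heq
      rintro ⟨⟨hv, hp⟩, hf⟩
      have hf : ∀ w, (N w (s + 1) ω - N w s ω = 0 ↔ w ≠ v) := hf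
      have hle := (hpath.counting v).mono (le_add_of_nonneg_right zero_le_one : s ≤ s + 1)
      have hv1 : N v (s + 1) ω - N v s ω ≠ 0 := fun h0 => (hf v).1 h0 rfl
      have := hpath.zeroPairs_ssubset (le_add_of_nonneg_right zero_le_one : s ≤ s + 1) (v := v)
        (by omega) (fun w hw => by have := (hf w).2 hw; omega) hv hp hvp
      rw [heq] at this
      exact this.ne rfl
    rw [hnull] at hmul
    have := (mul_eq_zero.1 hmul.symm).resolve_right hFpos
    filter_upwards [measure_eq_zero_iff_ae_notMem.1 this] with ω hω using hω
  have h2 : ∀ᵐ ω ∂μ, ∀ v p, G.Adj v p.1 → ¬ (M s ω v ≠ 0 ∧ p ∈ zeroPairs G (M s ω)) := by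
    rw [ae_all_iff]
    intro v
    rw [ae_all_iff]
    intro p
    by_cases hvp : G.Adj v p.1
    · filter_upwards [h1 v p hvp] with ω hω using fun _ => hω
    · exact Eventually.of_forall fun _ h => absurd h hvp
  filter_upwards [h2, h.ae_isMeteorPath] with ω h3 h4
  by_contra hne
  have hV : 0 < Fintype.card V := Fintype.card_pos_iff.2 hG.nonempty
  have hpos : ∃ w, M s ω w ≠ 0 := by
    by_contra hno
    push Not at hno
    have := h4.total_mass s
    simp only [hno, Finset.sum_const_zero] at this
    exact hV.ne (by exact_mod_cast this)
  obtain ⟨v, hv, p, hp, hvp⟩ :=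
    exists_pos_adj_zeroPair hG hpos (Set.nonempty_iff_ne_empty.2 hne)
  exact h3 v p hvp ⟨hv, hp⟩

lemma IsMeteorProcess.ae_injective_ratLastJump (h : IsMeteorProcess G μ N M) :
    ∀ᵐ ω ∂μ, Function.Injective fun v => ratLastJump fun t => N v t ω := by
  have hind := h.indep.comp (fun _ => ratLastJump) (fun _ => measurable_ratLastJump)
  have h1 : ∀ v w, v ≠ w →
      ∀ᵐ ω ∂μ, ratLastJump (fun t => N v t ω) ≠ ratLastJump fun t => N w t ω := fun v w hvw =>
    ae_ne_of_indepFun (h.poisson v).measurable_ratLastJump (h.poisson w).measurable_ratLastJump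
      (hind.indepFun hvw) (h.poisson w).measure_ratLastJump_eq
  have h2 : ∀ᵐ ω ∂μ, ∀ v w, v ≠ w →
      ratLastJump (fun t => N v t ω) ≠ ratLastJump fun t => N w t ω := by
    simp only [ae_all_iff]
    exact h1
  filter_upwards [h2] with ω hω v w he
  by_contra hvw
  exact hω v w hvw he

lemma IsStationaryMeteorProcess.ae_craters_eq (hG : G.Connected)
    (h : IsStationaryMeteorProcess G μ N M) :
    ∀ᵐ ω ∂μ, craters (M 0 ω) = {v | ∀ x, G.Adj v x →
      lastJump (fun t => N x t ω) < lastJump (fun t => N v t ω)} := by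
  -- Countably many times keep the exceptional set null, and `craters_eq` needs only arbitrarily
  -- early times.
  have hz : ∀ᵐ ω ∂μ, ∀ n : ℕ, zeroPairs G (M (-n) ω) = ∅ :=
    ae_all_iff.2 fun n => h.ae_zeroPairs_eq_empty hG _
  filter_upwards [h.ae_isMeteorPath, hz, h.ae_injective_ratLastJump,
    ae_all_iff.2 fun v => (h.poisson v).ae_ratLastJump,
    ae_all_iff.2 fun v => (h.poisson v).ae_exists_past] with ω h1 h2 h3 h4 h5
  refine h1.craters_eq (fun v => ?_) (fun s => ?_) ?_
  · obtain ⟨s, -, hs⟩ := h5 v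
    exact ⟨s, hs⟩
  · obtain ⟨n, hn⟩ := exists_nat_gt (-s)
    exact ⟨-n, by linarith, h2 n⟩
  · intro v w hvw
    apply h3
    simp only [(h4 _).1]
    exact hvw

end Graph

/-! ### Positions on the circle -/

section Circle

variable {k : ℕ} [NeZero k]

/-- The site `l` steps to the right of `b` on the circular graph. -/
def shift (b : Fin k) (l : ℕ) : Fin k := b + Fin.ofNat k l

lemma shift_zero (b : Fin k) : shift b 0 = b := by
  have : Fin.ofNat k 0 = 0 := rfl
  rw [shift, this, add_zero]

lemma shift_add (b : Fin k) (e l : ℕ) : shift (shift b e) l = shift b (e + l) := by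
  have : Fin.ofNat k (e + l) = Fin.ofNat k e + Fin.ofNat k l := by
    ext
    simp [Fin.val_add, Nat.add_mod]
  rw [shift, shift, shift, this, add_assoc]

lemma shift_self (b : Fin k) : shift b k = b := by
  have : Fin.ofNat k k = 0 := by
    ext
    simp
  rw [shift, this, add_zero]

lemma arcLength_shift (b : Fin k) {l : ℕ} (hl : l < k) : arcLength b (shift b l) = l := by
  rw [arcLength, shift, add_sub_cancel_left, Fin.val_ofNat, Nat.mod_eq_of_lt hl]

lemma shift_arcLength (b x : Fin k) : shift b (arcLength b x) = x := by
  have : Fin.ofNat k (arcLength b x) = x - b := by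
    ext
    rw [Fin.val_ofNat, arcLength, Nat.mod_eq_of_lt (x - b).isLt]
  rw [shift, this, add_sub_cancel]

omit [NeZero k] in
lemma arcLength_lt (b x : Fin k) : arcLength b x < k := (x - b).isLt

lemma shift_injOn (b : Fin k) {l l' : ℕ} (hl : l < k) (hl' : l' < k)
    (h : shift b l = shift b l') : l = l' := by
  rw [← arcLength_shift b hl, h, arcLength_shift b hl']

lemma arcLength_pos {i j : Fin k} (h : i ≠ j) : 0 < arcLength i j := by
  refine Nat.pos_of_ne_zero fun h0 => h ?_
  rw [← shift_arcLength i j, h0, shift_zero]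

lemma arcLength_shift_shift (b : Fin k) {e l : ℕ} (h : l < k) :
    arcLength (shift b e) (shift b (e + l)) = l := by
  rw [← shift_add, arcLength_shift _ h]

lemma cycleGraph_adj_shift (hk : 3 ≤ k) (b x : Fin k) (l : ℕ) :
    (SimpleGraph.cycleGraph k).Adj (shift b (l + 1)) x ↔ x = shift b l ∨ x = shift b (l + 2) := by
  rw [SimpleGraph.cycleGraph_adj', or_comm (a := x = _)]
  have h1 : ∀ y z : Fin k, (z - y).val = 1 ↔ z = shift y 1 := fun y z => by
    constructor
    · intro h
      rw [← shift_arcLength y z, arcLength, h]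
    · rintro rfl
      exact arcLength_shift y (by omega)
  rw [or_comm, h1, h1, shift_add]
  refine or_congr_right ⟨fun h => ?_, fun h => ?_⟩
  · have h2 : shift (shift b (l + 1)) (k - 1) = shift (shift x 1) (k - 1) := by rw [h]
    rw [shift_add, shift_add, show l + 1 + (k - 1) = l + k by omega,
      show 1 + (k - 1) = k by omega, shift_self, ← shift_add, shift_self] at h2
    exact h2.symm
  · rw [h, shift_add]

open Classical in
lemma ncard_eq_count (b : Fin k) (S : Set (Fin k)) :
    S.ncard = Nat.count (fun l => shift b l ∈ S) k := by
  rw [Nat.count_eq_card_filter_range, ← Set.ncard_coe_finset]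
  refine (Set.ncard_congr (fun l _ => shift b l) ?_ ?_ ?_).symm
  · intro l hl
    simpa using (by simpa using hl : l < k ∧ shift b l ∈ S).2
  · intro l l' hl hl' h
    exact shift_injOn b (by simpa using hl : l < k ∧ shift b l ∈ S).1
      (by simpa using hl' : l' < k ∧ shift b l' ∈ S).1 h
  · intro x hx
    refine ⟨arcLength b x, ?_, shift_arcLength b x⟩
    simp [arcLength_lt, shift_arcLength, hx]

/-! ### Local extrema of a permutation of the circle -/

/-- Strict local maxima of a permutation of the circle. -/
def peaks (σ : Equiv.Perm (Fin k)) : Set (Fin k) :=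
  {v | ∀ x, (SimpleGraph.cycleGraph k).Adj v x → σ x < σ v}

/-- Strict local minima of a permutation of the circle. -/
def valleys (σ : Equiv.Perm (Fin k)) : Set (Fin k) :=
  {v | ∀ x, (SimpleGraph.cycleGraph k).Adj v x → σ v < σ x}

variable (σ : Equiv.Perm (Fin k)) (b : Fin k)

/-- The permutation goes up in the step number `l` from the base site `b`. -/
def IsUp (l : ℕ) : Prop := σ (shift b l) < σ (shift b (l + 1))

/-- The permutation changes its direction `l ≥ 1` steps to the right of the base site `b`. -/
def IsTurn (l : ℕ) : Prop := 1 ≤ l ∧ ¬ (IsUp σ b (l - 1) ↔ IsUp σ b l)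

variable {σ b}

lemma shift_succ_ne (hk : 3 ≤ k) (l : ℕ) : shift b l ≠ shift b (l + 1) := fun h => by
  have := arcLength_shift_shift b (e := l) (l := 1) (by omega)
  rw [← h] at this
  simp [arcLength] at this

lemma not_isUp (hk : 3 ≤ k) {l : ℕ} :
    ¬ IsUp σ b l ↔ σ (shift b (l + 1)) < σ (shift b l) := by
  rw [IsUp, not_lt]
  exact ⟨fun h => lt_of_le_of_ne h fun he => shift_succ_ne hk l (σ.injective he).symm, le_of_lt⟩

lemma shift_mem_peaks (hk : 3 ≤ k) (l : ℕ) :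
    shift b (l + 1) ∈ peaks σ ↔ IsUp σ b l ∧ ¬ IsUp σ b (l + 1) := by
  rw [not_isUp hk, peaks, Set.mem_ofPred_eq]
  simp only [cycleGraph_adj_shift hk, forall_eq_or_imp, forall_eq]
  rfl

lemma shift_mem_valleys (hk : 3 ≤ k) (l : ℕ) :
    shift b (l + 1) ∈ valleys σ ↔ ¬ IsUp σ b l ∧ IsUp σ b (l + 1) := by
  rw [not_isUp hk, valleys, Set.mem_ofPred_eq]
  simp only [cycleGraph_adj_shift hk, forall_eq_or_imp, forall_eq]
  rfl

lemma shift_mem_extrema (hk : 3 ≤ k) {l : ℕ} (hl : 1 ≤ l) :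
    shift b l ∈ peaks σ ∪ valleys σ ↔ IsTurn σ b l := by
  obtain ⟨l, rfl⟩ : ∃ j, l = j + 1 := ⟨l - 1, by omega⟩
  rw [Set.mem_union, shift_mem_peaks hk, shift_mem_valleys hk, IsTurn, Nat.add_sub_cancel]
  tauto

lemma disjoint_peaks_valleys (hk : 3 ≤ k) {v : Fin k} (h1 : v ∈ peaks σ) (h2 : v ∈ valleys σ) :
    False := by
  rw [← shift_self v] at h1 h2
  obtain ⟨l, hl⟩ : ∃ l, k = l + 1 := ⟨k - 1, by omega⟩
  have e : shift v k = shift v (l + 1) := by rw [← hl]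
  rw [e] at h1 h2
  exact ((shift_mem_valleys hk l).1 h2).1 ((shift_mem_peaks hk l).1 h1).1

/-- The direction does not change on a stretch without turns. -/
lemma isUp_iff_of_no_turn {e l : ℕ} (hel : e ≤ l)
    (h : ∀ j, e < j → j ≤ l → ¬ IsTurn σ b j) : IsUp σ b l ↔ IsUp σ b e := by
  induction l, hel using Nat.le_induction with
  | base => rfl
  | succ l hl ih =>
    have h1 := h (l + 1) (by omega) le_rfl
    simp only [IsTurn, Nat.add_sub_cancel, not_and, not_not] at h1
    rw [← h1 (by omega)]
    exact ih fun j h2 h3 => h j h2 (by omega)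

/-- Between two adjacent peaks there is exactly one valley. -/
lemma exists_valley_between (hk : 3 ≤ k) {p : Fin k × Fin k} (hp : p ∈ adjacentPairs (peaks σ)) :
    ∃ x, (p.1, x) ∈ adjacentMixedPairs (peaks σ) (valleys σ) ∧
      (x, p.2) ∈ adjacentMixedPairs (peaks σ) (valleys σ) ∧
      arcLength p.1 x + arcLength x p.2 = arcLength p.1 p.2 := by
  classical
  obtain ⟨i, j⟩ := p
  obtain ⟨hij, hi, hj, hbet⟩ := hp
  simp only at hij hi hj hbet ⊢
  have hLpos := arcLength_pos hij
  have hLlt := arcLength_lt i j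
  have hjL : shift i (arcLength i j) = j := shift_arcLength i j
  set L := arcLength i j with hL
  have hbet' : ∀ l, 0 < l → l < L → shift i l ∉ peaks σ := fun l h1 h2 =>
    hbet _ ⟨by rwa [arcLength_shift i (by omega)], by rwa [arcLength_shift i (by omega)]⟩
  have hturnL : IsTurn σ i L := (shift_mem_extrema hk hLpos).1 (Or.inl (hjL.symm ▸ hj))
  have h0 : ¬ IsUp σ i 0 := by
    rw [not_isUp hk, shift_zero]
    have hadj := (cycleGraph_adj_shift hk i (shift i 1) (k - 1)).2 (Or.inr (by
      rw [show k - 1 + 2 = k + 1 by omega, ← shift_add, shift_self]))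
    rw [show k - 1 + 1 = k by omega, shift_self] at hadj
    exact hi _ hadj
  -- The path descends from the peak `i`, so its first turn `a` is a valley and its next turn `c` is
  -- a peak, which must be `j`.
  have hex1 : ∃ l, IsTurn σ i l := ⟨L, hturnL⟩
  obtain ⟨a, ha⟩ : ∃ a, a = Nat.find hex1 := ⟨_, rfl⟩
  have ha1 : IsTurn σ i a := ha ▸ Nat.find_spec hex1
  have ha2 : ∀ l < a, ¬ IsTurn σ i l := fun l hl => Nat.find_min hex1 (ha ▸ hl)
  have haL : a ≤ L := ha ▸ Nat.find_min' hex1 hturnL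
  have hapos := ha1.1
  have hdown : ¬ IsUp σ i (a - 1) := by
    rw [isUp_iff_of_no_turn (Nat.zero_le _) fun j _ h2 => ha2 j (by omega)]
    exact h0
  have haup : IsUp σ i a := by
    have := ha1.2
    tauto
  have hval : shift i a ∈ valleys σ := by
    have := shift_mem_valleys (σ := σ) (b := i) hk (a - 1)
    rw [Nat.sub_add_cancel hapos] at this
    exact this.2 ⟨hdown, haup⟩
  have haL' : a < L := lt_of_le_of_ne haL fun he => by
    rw [he, hjL] at hval
    exact disjoint_peaks_valleys hk hj hval
  have hex2 : ∃ l, a < l ∧ IsTurn σ i l := ⟨L, haL', hturnL⟩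
  obtain ⟨c, hc⟩ : ∃ c, c = Nat.find hex2 := ⟨_, rfl⟩
  have hc1 : a < c ∧ IsTurn σ i c := hc ▸ Nat.find_spec hex2
  have hc2 : ∀ l, a < l → l < c → ¬ IsTurn σ i l := fun l h1 h2 h3 =>
    Nat.find_min hex2 (hc ▸ h2) ⟨h1, h3⟩
  have hcL : c ≤ L := hc ▸ Nat.find_min' hex2 ⟨haL', hturnL⟩
  have hcup : IsUp σ i (c - 1) := by
    rw [isUp_iff_of_no_turn (e := a) (by omega) fun j h1 h2 => hc2 j h1 (by omega)]
    exact haup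
  have hcdown : ¬ IsUp σ i c := by
    have := hc1.2.2
    tauto
  have hpk : shift i c ∈ peaks σ := by
    have := shift_mem_peaks (σ := σ) (b := i) hk (c - 1)
    rw [Nat.sub_add_cancel (by omega)] at this
    exact this.2 ⟨hcup, hcdown⟩
  have hcL' : c = L := by
    by_contra hne
    exact hbet' c (by omega) (by omega) hpk
  have e1 : arcLength i (shift i a) = a := arcLength_shift i (by omega)
  have e2 : arcLength (shift i a) j = L - a := by
    have := arcLength_shift_shift i (e := a) (l := L - a) (by omega)
    rwa [Nat.add_sub_cancel' haL, hjL] at this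
  have hnot : ∀ x, ¬ (x ∈ peaks σ ∪ valleys σ) → x ∉ peaks σ ∧ x ∉ valleys σ := fun x hx =>
    ⟨fun h => hx (Or.inl h), fun h => hx (Or.inr h)⟩
  refine ⟨shift i a, ⟨Or.inl ⟨hi, hval⟩, fun l hl => hnot l ?_⟩,
    ⟨Or.inr ⟨hval, hj⟩, fun l hl => hnot l ?_⟩, by omega⟩
  · obtain ⟨h1, h2⟩ := hl
    simp only [e1] at h1 h2
    rw [← shift_arcLength i l, shift_mem_extrema hk h1]
    exact ha2 _ h2
  · obtain ⟨h1, h2⟩ := hl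
    simp only [e2] at h1 h2
    rw [← shift_arcLength (shift i a) l, shift_add, shift_mem_extrema hk (by omega)]
    exact hc2 _ (by omega) (by omega)

/-! ### Runs of a permutation of the circle -/

open Classical in
/-- The number of turns before the site `l` steps to the right of the base site. -/
noncomputable def runIndex (σ : Equiv.Perm (Fin k)) (b : Fin k) (l : ℕ) : ℕ :=
  Nat.count (IsTurn σ b) l

lemma runIndex_mono {l l' : ℕ} (h : l ≤ l') : runIndex σ b l ≤ runIndex σ b l' := by
  classical
  exact Nat.count_monotone _ h

lemma runIndex_succ_of_turn {l : ℕ} (h : IsTurn σ b l) :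
    runIndex σ b (l + 1) = runIndex σ b l + 1 := by
  classical
  rw [runIndex, Nat.count_succ, if_pos h]
  rfl

lemma runIndex_succ_of_not_turn {l : ℕ} (h : ¬ IsTurn σ b l) :
    runIndex σ b (l + 1) = runIndex σ b l := by
  classical
  rw [runIndex, Nat.count_succ, if_neg h]
  rfl

lemma runIndex_zero : runIndex σ b 0 = 0 := by
  classical
  exact Nat.count_zero _

lemma runIndex_one : runIndex σ b 1 = 0 := by
  rw [runIndex_succ_of_not_turn fun h => absurd h.1 (by omega), runIndex_zero]

lemma runIndex_eq_of_no_turn {e l : ℕ} (hel : e ≤ l)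
    (h : ∀ j, e ≤ j → j < l → ¬ IsTurn σ b j) : runIndex σ b l = runIndex σ b e := by
  induction l, hel using Nat.le_induction with
  | base => rfl
  | succ l hl ih =>
    rw [runIndex_succ_of_not_turn (h l hl (by omega))]
    exact ih fun j h2 h3 => h j h2 (by omega)

/-- The position of the smallest value, used as the base site. -/
def bottom (σ : Equiv.Perm (Fin k)) : Fin k := σ.symm 0

lemma bottom_lt {x : Fin k} (hx : x ≠ bottom σ) : σ (bottom σ) < σ x := by
  rw [bottom, Equiv.apply_symm_apply, Fin.pos_iff_ne_zero]
  intro h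
  apply hx
  rw [bottom, ← h, Equiv.symm_apply_apply]

lemma bottom_mem_valleys : bottom σ ∈ valleys σ := fun _ hx => bottom_lt hx.ne'

lemma isUp_bottom_zero (hk : 3 ≤ k) : IsUp σ (bottom σ) 0 := by
  rw [IsUp, shift_zero]
  refine bottom_lt fun h => shift_succ_ne (b := bottom σ) hk 0 ?_
  rw [shift_zero]
  exact h.symm

lemma not_isUp_bottom_last (hk : 3 ≤ k) : ¬ IsUp σ (bottom σ) (k - 1) := by
  have h1 := shift_succ_ne (b := bottom σ) hk (k - 1)
  rw [not_isUp hk]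
  rw [show k - 1 + 1 = k by omega, shift_self] at h1 ⊢
  exact bottom_lt h1

/-- From the smallest value the first step is up, and each turn reverses the direction. The argument
`l + 1` includes a turn at `l` itself. -/
lemma isUp_iff_even (hk : 3 ≤ k) (l : ℕ) :
    IsUp σ (bottom σ) l ↔ Even (runIndex σ (bottom σ) (l + 1)) := by
  induction l with
  | zero => simp [isUp_bottom_zero hk, runIndex_one]
  | succ l ih =>
    by_cases h : IsTurn σ (bottom σ) (l + 1)
    · rw [runIndex_succ_of_turn h, Nat.even_add_one, ← ih]
      have := h.2
      rw [Nat.add_sub_cancel] at this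
      tauto
    · rw [runIndex_succ_of_not_turn h, ← ih]
      have h' := h
      simp only [IsTurn, Nat.add_sub_cancel, not_and, not_not] at h'
      exact (h' (by omega)).symm

lemma not_even_runIndex_last (hk : 3 ≤ k) : ¬ Even (runIndex σ (bottom σ) k) := by
  have h := (isUp_iff_even (σ := σ) hk (k - 1)).not.1 (not_isUp_bottom_last hk)
  rwa [Nat.sub_add_cancel (by omega)] at h

/-- Turns alternate between peaks and valleys, beginning with a peak. -/
lemma ncard_peaks (hk : 3 ≤ k) : (peaks σ).ncard = (runIndex σ (bottom σ) k + 1) / 2 := by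
  classical
  rw [ncard_eq_count (bottom σ)]
  have key : ∀ l, Nat.count (fun l => shift (bottom σ) l ∈ peaks σ) (l + 1) =
      (runIndex σ (bottom σ) (l + 1) + 1) / 2 := by
    intro l
    induction l with
    | zero =>
      have : bottom σ ∉ peaks σ := fun h => disjoint_peaks_valleys hk h bottom_mem_valleys
      rw [Nat.count_succ, zero_add, runIndex_one, shift_zero, if_neg this]
      simp
    | succ l ih =>
      rw [Nat.count_succ, ih]
      have hev := isUp_iff_even (σ := σ) hk l
      have hmem := shift_mem_peaks (σ := σ) (b := bottom σ) hk l
      rw [Nat.even_iff] at hev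
      by_cases h : IsTurn σ (bottom σ) (l + 1)
      · rw [runIndex_succ_of_turn h]
        have h2 := h.2
        rw [Nat.add_sub_cancel] at h2
        by_cases hu : IsUp σ (bottom σ) l
        · rw [if_pos (hmem.2 ⟨hu, by tauto⟩)]
          have := hev.1 hu
          omega
        · rw [if_neg fun h3 => hu (hmem.1 h3).1]
          have := hev.not.1 hu
          omega
      · rw [runIndex_succ_of_not_turn h,
          if_neg fun h3 => h ((shift_mem_extrema hk (by omega)).1 (Or.inl h3)), add_zero]
  have := key (k - 1)
  rwa [Nat.sub_add_cancel (by omega)] at this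

/-- The additional 1 is the base site, a valley that is never counted as a turn. -/
lemma ncard_extrema (hk : 3 ≤ k) :
    (peaks σ ∪ valleys σ).ncard = runIndex σ (bottom σ) k + 1 := by
  classical
  have hbot : bottom σ ∈ peaks σ ∪ valleys σ := Or.inr bottom_mem_valleys
  have hmem : ∀ l, 1 ≤ l → (shift (bottom σ) l ∈ peaks σ ∪ valleys σ ↔ IsTurn σ (bottom σ) l) :=
    fun l hl => shift_mem_extrema hk hl
  generalize peaks σ ∪ valleys σ = S at hbot hmem
  rw [ncard_eq_count (bottom σ)]
  have key : ∀ l, Nat.count (fun l => shift (bottom σ) l ∈ S) (l + 1) =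
      runIndex σ (bottom σ) (l + 1) + 1 := by
    intro l
    induction l with
    | zero =>
      rw [Nat.count_succ, zero_add, runIndex_one, shift_zero, if_pos hbot]
      simp
    | succ l ih =>
      rw [Nat.count_succ, ih, if_congr (hmem (l + 1) (by omega)) rfl rfl]
      split_ifs with h
      · rw [runIndex_succ_of_turn h]
      · rw [runIndex_succ_of_not_turn h]
  have := key (k - 1)
  rwa [Nat.sub_add_cancel (by omega)] at this

lemma ncard_extrema_eq (hk : 3 ≤ k) : (peaks σ ∪ valleys σ).ncard = 2 * (peaks σ).ncard := by
  rw [ncard_extrema hk, ncard_peaks hk]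
  have := not_even_runIndex_last (σ := σ) hk
  rw [Nat.even_iff] at this
  omega

lemma runIndex_lt (hk : 3 ≤ k) {l : ℕ} (hl : l ≤ k) :
    runIndex σ (bottom σ) l < 2 * (peaks σ).ncard := by
  rw [← ncard_extrema_eq hk, ncard_extrema hk]
  exact Nat.lt_succ_of_le (runIndex_mono hl)

/-- A run is increasing or decreasing depending on the parity of its index. -/
lemma lt_of_runIndex_eq (hk : 3 ≤ k) {l l' : ℕ} (hl : l < l')
    (h : runIndex σ (bottom σ) l = runIndex σ (bottom σ) l') :
    if Even (runIndex σ (bottom σ) l) then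
      σ (shift (bottom σ) l) < σ (shift (bottom σ) l')
    else σ (shift (bottom σ) l') < σ (shift (bottom σ) l) := by
  have hstep : ∀ j, l ≤ j → j < l' → (IsUp σ (bottom σ) j ↔ Even (runIndex σ (bottom σ) l)) := by
    intro j h1 h2
    rw [isUp_iff_even hk]
    have h3 := runIndex_mono (σ := σ) (b := bottom σ) (show l ≤ j + 1 by omega)
    have h4 := runIndex_mono (σ := σ) (b := bottom σ) (show j + 1 ≤ l' by omega)
    rw [show runIndex σ (bottom σ) (j + 1) = runIndex σ (bottom σ) l by omega]
  clear h
  have aux : ∀ j, l + 1 ≤ j → j ≤ l' → if Even (runIndex σ (bottom σ) l) then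
      σ (shift (bottom σ) l) < σ (shift (bottom σ) j)
      else σ (shift (bottom σ) j) < σ (shift (bottom σ) l) := by
    intro j hj
    induction j, hj using Nat.le_induction with
    | base =>
      intro h1
      have := hstep l le_rfl hl
      split_ifs with he
      · exact this.2 he
      · exact (not_isUp hk).1 (this.not.2 he)
    | succ j hj ih =>
      intro h1
      have h2 := ih (by omega)
      have := hstep j (by omega) (by omega)
      split_ifs at h2 ⊢ with he
      · exact h2.trans (this.2 he)
      · exact ((not_isUp hk).1 (this.not.2 he)).trans h2
  exact aux l' hl le_rfl

/-- The index of the run that contains a given value. -/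
noncomputable def valueRun (σ : Equiv.Perm (Fin k)) (a : Fin k) : ℕ :=
  runIndex σ (bottom σ) (arcLength (bottom σ) (σ.symm a))

lemma valueRun_lt (hk : 3 ≤ k) (a : Fin k) : valueRun σ a < 2 * (peaks σ).ncard :=
  runIndex_lt hk (arcLength_lt _ _).le

/-- The order of the positions is determined by the indices of runs. -/
lemma arcLength_lt_iff (hk : 3 ≤ k) (a a' : Fin k) :
    arcLength (bottom σ) (σ.symm a) < arcLength (bottom σ) (σ.symm a') ↔
      valueRun σ a < valueRun σ a' ∨ (valueRun σ a = valueRun σ a' ∧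
        if Even (valueRun σ a) then a < a' else a' < a) := by
  have key : ∀ c c', arcLength (bottom σ) (σ.symm c) < arcLength (bottom σ) (σ.symm c') →
      valueRun σ c < valueRun σ c' ∨ (valueRun σ c = valueRun σ c' ∧
        if Even (valueRun σ c) then c < c' else c' < c) := fun c c' h => by
    rcases (runIndex_mono (σ := σ) (b := bottom σ) h.le).lt_or_eq with h1 | h1
    · exact Or.inl h1
    · refine Or.inr ⟨h1, ?_⟩
      have := lt_of_runIndex_eq hk h h1
      simp only [shift_arcLength, Equiv.apply_symm_apply] at this
      exact this
  refine ⟨key a a', fun h => ?_⟩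
  by_contra hno
  rcases (not_lt.1 hno).lt_or_eq with h1 | h1
  · have h2 := key a' a h1
    rcases h with h | ⟨h, h'⟩
    · rcases h2 with h2 | ⟨h2, -⟩ <;> omega
    · rcases h2 with h2 | ⟨-, h2⟩
      · omega
      · rw [h] at h'
        split_ifs at h' h2
        · exact lt_asymm h' h2
        · exact lt_asymm h' h2
  · have h2 : a' = a := by
      have := congrArg (fun l => σ (shift (bottom σ) l)) h1
      simpa only [shift_arcLength, Equiv.apply_symm_apply] using this
    subst h2
    rcases h with h | ⟨-, h⟩
    · exact lt_irrefl _ h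
    · split_ifs at h <;> exact lt_irrefl _ h

/-- A permutation is determined by the position of the smallest value and the indices of the
runs that contain its values. -/
lemma eq_of_valueRun_eq (hk : 3 ≤ k) {σ τ : Equiv.Perm (Fin k)} (hb : bottom σ = bottom τ)
    (h : ∀ a, valueRun σ a = valueRun τ a) : σ = τ := by
  -- `pos ρ a` is the distance from the base site to the value `a`. Equal run indices order these
  -- distances equally, and `Fin k` has no order automorphism but the identity.
  let pos : Equiv.Perm (Fin k) → Equiv.Perm (Fin k) := fun ρ =>
    ρ.symm.trans (Equiv.subRight (bottom ρ))
  have hpos : ∀ ρ a a', pos ρ a < pos ρ a' ↔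
      arcLength (bottom ρ) (ρ.symm a) < arcLength (bottom ρ) (ρ.symm a') := fun ρ a a' => Iff.rfl
  have hlt : ∀ a a', pos σ a < pos σ a' ↔ pos τ a < pos τ a' := fun a a' => by
    rw [hpos, hpos, arcLength_lt_iff hk, arcLength_lt_iff hk, h, h]
  let e : Fin k ≃o Fin k :=
    { (pos σ).symm.trans (pos τ) with
      map_rel_iff' := fun {i j} => by
        rw [← not_lt, ← not_lt]
        refine not_congr ?_
        change pos τ ((pos σ).symm j) < pos τ ((pos σ).symm i) ↔ j < i
        rw [← hlt]
        simp }
  have he : e = OrderIso.refl _ := Subsingleton.elim _ _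
  have hsymm : ∀ a, σ.symm a = τ.symm a := fun a => by
    have h3 : e (pos σ a) = pos σ a := by rw [he, OrderIso.refl_apply]
    have h4 : e (pos σ a) = pos τ a := congrArg (pos τ) ((pos σ).symm_apply_apply a)
    have h5 : σ.symm a - bottom σ = τ.symm a - bottom τ := h3.symm.trans h4
    rwa [hb, sub_left_inj] at h5
  exact Equiv.symm_bijective.injective (Equiv.ext hsymm)

/-- The number of values in a run. -/
noncomputable def runCard (σ : Equiv.Perm (Fin k)) (r : ℕ) : ℕ :=
  (Finset.univ.filter fun a => valueRun σ a = r).card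

lemma runCard_eq (r : ℕ) :
    runCard σ r = ((Finset.range k).filter fun l => runIndex σ (bottom σ) l = r).card := by
  refine Finset.card_bij (fun a _ => arcLength (bottom σ) (σ.symm a)) ?_ ?_ ?_
  · intro a ha
    simp only [Finset.mem_filter, Finset.mem_univ, true_and, Finset.mem_range] at ha ⊢
    exact ⟨arcLength_lt _ _, ha⟩
  · intro a _ a' _ h
    have := congrArg (fun l => σ (shift (bottom σ) l)) h
    simpa only [shift_arcLength, Equiv.apply_symm_apply] using this
  · intro l hl
    simp only [Finset.mem_filter, Finset.mem_range] at hl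
    refine ⟨σ (shift (bottom σ) l), ?_, ?_⟩
    · rw [Finset.mem_filter]
      refine ⟨Finset.mem_univ _, ?_⟩
      rw [valueRun, Equiv.symm_apply_apply, arcLength_shift _ hl.1, hl.2]
    · rw [Equiv.symm_apply_apply, arcLength_shift _ hl.1]

lemma sum_runCard (hk : 3 ≤ k) {m : ℕ} (hm : 2 * (peaks σ).ncard = m) :
    ∑ r ∈ Finset.range m, runCard σ r = k := by
  classical
  have := Finset.card_eq_sum_card_fiberwise (f := valueRun σ) (s := Finset.univ)
    (t := Finset.range m) fun a _ => by
      simpa using hm ▸ valueRun_lt hk a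
  rw [Finset.card_univ, Fintype.card_fin] at this
  exact this.symm

/-- The distance between two consecutive extrema is close to the number of values in a run. -/
lemma exists_runCard_of_mixedPair (hk : 3 ≤ k) {p : Fin k × Fin k}
    (hp : p ∈ adjacentMixedPairs (peaks σ) (valleys σ)) :
    ∃ r < 2 * (peaks σ).ncard,
      runCard σ r ≤ arcLength p.1 p.2 + 1 ∧ arcLength p.1 p.2 ≤ runCard σ r + 1 := by
  classical
  obtain ⟨i, j⟩ := p
  obtain ⟨hij, hbet⟩ := hp
  simp only at hij hbet ⊢
  have hne : i ≠ j := by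
    rintro rfl
    rcases hij with h | h
    · exact disjoint_peaks_valleys hk h.1 h.2
    · exact disjoint_peaks_valleys hk h.2 h.1
  have hi : i ∈ peaks σ ∪ valleys σ := hij.elim (fun h => Or.inl h.1) fun h => Or.inr h.1
  have hj : j ∈ peaks σ ∪ valleys σ := hij.elim (fun h => Or.inr h.2) fun h => Or.inl h.2
  have hLpos := arcLength_pos hne
  have hLlt := arcLength_lt i j
  have hjL : shift i (arcLength i j) = j := shift_arcLength i j
  set L := arcLength i j with hL
  have hbet' : ∀ l, 0 < l → l < L → shift i l ∉ peaks σ ∪ valleys σ := fun l h1 h2 h3 => by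
    have h4 := hbet (shift i l)
      ⟨by rwa [arcLength_shift i (by omega)], by rwa [arcLength_shift i (by omega)]⟩
    exact h3.elim h4.1 h4.2
  set B := bottom σ with hB
  have hie : shift B (arcLength B i) = i := shift_arcLength B i
  have hek := arcLength_lt B i
  set e := arcLength B i with he
  -- The arc cannot pass over the base site, which is itself a valley.
  have heL : e + L ≤ k := by
    by_contra hlt
    have h1 : e ≠ 0 := fun h0 => by omega
    refine hbet' (k - e) (by omega) (by omega) ?_
    rw [← hie, shift_add, Nat.add_sub_cancel' hek.le, shift_self]
    exact Or.inr bottom_mem_valleys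
  have hnoturn : ∀ l, e < l → l < e + L → ¬ IsTurn σ B l := fun l h1 h2 => by
    rw [← shift_mem_extrema hk (by omega)]
    have := hbet' (l - e) (by omega) (by omega)
    rwa [← hie, shift_add, Nat.add_sub_cancel' h1.le] at this
  have hturn_e : 0 < e → IsTurn σ B e := fun h0 => by
    rw [← shift_mem_extrema hk (by omega), hie]
    exact hi
  have hturn_L : IsTurn σ B (e + L) := by
    rw [← shift_mem_extrema hk (by omega), ← shift_add, hie, hjL]
    exact hj
  have hconst : ∀ l, e < l → l ≤ e + L → runIndex σ B l = runIndex σ B (e + 1) := fun l h1 h2 =>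
    runIndex_eq_of_no_turn h1 fun j h3 h4 => hnoturn j (by omega) (by omega)
  -- A run contains its right end but not its left end, so it has `L` elements, up to one: the first
  -- run also contains the base site, and the last lacks its right end, which is the base site
  -- again.
  refine ⟨runIndex σ B (e + L), runIndex_lt hk heL, ?_, ?_⟩
  · rw [runCard_eq, ← hB]
    have hsub : ((Finset.range k).filter fun l => runIndex σ B l = runIndex σ B (e + L)) ⊆
        Finset.Icc e (e + L) := fun l hl => by
      simp only [Finset.mem_filter, Finset.mem_range, Finset.mem_Icc] at hl ⊢
      constructor
      · by_contra hlt
        have h1 := runIndex_mono (σ := σ) (b := B) (not_le.1 hlt).le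
        have h2 := runIndex_succ_of_turn (hturn_e (by omega))
        have h3 := hconst (e + L) (by omega) le_rfl
        omega
      · by_contra hlt
        have h1 := runIndex_mono (σ := σ) (b := B) (show e + L + 1 ≤ l by omega)
        have h2 := runIndex_succ_of_turn hturn_L
        omega
    refine (Finset.card_le_card hsub).trans ?_
    rw [Nat.card_Icc]
    omega
  · rw [runCard_eq, ← hB]
    have hsub : Finset.Ioo e (e + L) ⊆
        ((Finset.range k).filter fun l => runIndex σ B l = runIndex σ B (e + L)) := fun l hl => by
      simp only [Finset.mem_filter, Finset.mem_range, Finset.mem_Ioo] at hl ⊢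
      exact ⟨by omega, by rw [hconst l hl.1 hl.2.le, hconst (e + L) (by omega) le_rfl]⟩
    have := Finset.card_le_card hsub
    rw [Nat.card_Ioo] at this
    omega

end Circle

/-! ### Functions with a small fiber -/

/-- This is the tilt of the Chernoff bound. Both sides equal `m` at `y = 1`, with slopes `A > m *
B`, so the inequality holds slightly to the left of 1. -/
lemma exists_between_pow {m A B : ℕ} (h : m * B < A) :
    ∃ y : ℝ, 0 < y ∧ y < 1 ∧ (m : ℝ) - 1 + y ^ A < m * y ^ B := by
  have hA : (1 : ℝ) ≤ A := by exact_mod_cast (by omega : 1 ≤ A)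
  have hmB : (m : ℝ) * B ≤ A - 1 := by
    have : m * B + 1 ≤ A := h
    have : (m : ℝ) * B + 1 ≤ A := by exact_mod_cast this
    linarith
  -- With this `δ` one has `δ * A * (A - 1) < 1`, which absorbs the second-order term in the bound
  -- on `(1 - δ) ^ A`.
  obtain ⟨δ, hδ0, hδ⟩ : ∃ δ : ℝ, 0 < δ ∧ δ * (A + 1) ^ 2 = 1 :=
    ⟨1 / ((A : ℝ) + 1) ^ 2, by positivity, by field_simp⟩
  have hδ1 : δ < 1 := by nlinarith
  refine ⟨1 - δ, by linarith, by linarith, ?_⟩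
  have h1 : 1 - B * δ ≤ (1 - δ) ^ B := by
    have := one_add_mul_le_pow (a := -δ) (by linarith) B
    rw [← sub_eq_add_neg] at this
    linarith
  have h2 : (1 - δ) ^ A * (1 + A * δ) ≤ 1 := by
    have h3 := one_add_mul_le_pow (a := δ) (by linarith) A
    have h4 : 0 ≤ (1 - δ) ^ A := pow_nonneg (by linarith) A
    calc (1 - δ) ^ A * (1 + A * δ) ≤ (1 - δ) ^ A * (1 + δ) ^ A := by gcongr
      _ = (1 - δ ^ 2) ^ A := by rw [← mul_pow]; ring
      _ ≤ 1 := pow_le_one₀ (by nlinarith) (by nlinarith)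
  have h3 : (1 - δ) ^ A < 1 - (A - 1) * δ := by
    have h4 : 1 < (1 - (A - 1) * δ) * (1 + A * δ) := by
      have h5 : (1 - ((A : ℝ) - 1) * δ) * (1 + A * δ) = 1 + δ * (1 - δ * (A * (A - 1))) := by ring
      have h6 : 0 < 1 - δ * ((A : ℝ) * (A - 1)) := by nlinarith
      have := mul_pos hδ0 h6
      linarith
    have h5 : 0 < 1 + A * δ := by positivity
    exact lt_of_mul_lt_mul_right (h2.trans_lt h4) h5.le
  have h4 : (m : ℝ) * (1 - B * δ) ≤ m * (1 - δ) ^ B := by gcongr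
  nlinarith

/-- The functions `Fin k → Fin m` with a fiber of size less than `B * k / A`, where `B / A` is
less than `1 / m`, form an exponentially small part of all functions. -/
lemma exists_card_small_fiber_le {m A B : ℕ} (h : m * B < A) :
    ∃ ρ : ℝ, 0 ≤ ρ ∧ ρ < 1 ∧ ∀ k : ℕ,
      ((Finset.univ.filter fun f : Fin k → Fin m =>
        ∃ r, A * (Finset.univ.filter fun a => f a = r).card < B * k).card : ℝ) ≤
        m * (ρ * m) ^ k := by
  classical
  rcases Nat.eq_zero_or_pos m with rfl | hm
  · refine ⟨0, le_rfl, zero_lt_one, fun k => ?_⟩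
    simp
  obtain ⟨y, hy0, hy1, hy⟩ := exists_between_pow h
  have hm' : (1 : ℝ) ≤ m := by exact_mod_cast hm
  have hnum : 0 ≤ (m : ℝ) - 1 + y ^ A := by have := pow_pos hy0 A; linarith
  have hden : 0 < (m : ℝ) * y ^ B := by positivity
  refine ⟨((m : ℝ) - 1 + y ^ A) / (m * y ^ B), by positivity, (div_lt_one hden).2 hy, fun k => ?_⟩
  have hρ : ((m : ℝ) - 1 + y ^ A) / (m * y ^ B) * m = ((m : ℝ) - 1 + y ^ A) / y ^ B := by
    field_simp
  rw [hρ]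
  -- Exponential Markov inequality: weight `f` by `y ^ (A * |fiber over r|)`. The weights sum to `(m
  -- - 1 + y ^ A) ^ k`, and a function with a small fiber weighs at least `y ^ (B * k)`.
  have hone : ∀ r : Fin m, ((Finset.univ.filter fun f : Fin k → Fin m =>
      A * (Finset.univ.filter fun a => f a = r).card < B * k).card : ℝ) ≤
      (((m : ℝ) - 1 + y ^ A) / y ^ B) ^ k := by
    intro r
    have hsum : ∑ b : Fin m, (if b = r then y ^ A else 1) = (m : ℝ) - 1 + y ^ A := by
      rw [Finset.sum_ite, Finset.filter_eq' Finset.univ r, if_pos (Finset.mem_univ r),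
        Finset.sum_singleton, Finset.sum_const, Finset.filter_ne' Finset.univ r,
        Finset.card_erase_of_mem (Finset.mem_univ r), Finset.card_univ, Fintype.card_fin,
        nsmul_eq_mul, Nat.cast_sub hm]
      push_cast
      ring
    have hprod : ∀ f : Fin k → Fin m, ∏ i, (if f i = r then y ^ A else 1) =
        y ^ (A * (Finset.univ.filter fun a => f a = r).card) := fun f => by
      rw [Finset.prod_ite, Finset.prod_const, Finset.prod_const_one, mul_one, pow_mul]
    rw [div_pow, le_div_iff₀ (by positivity), ← hsum, Fintype.sum_pow, ← nsmul_eq_mul,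
      ← Finset.sum_const]
    refine (Finset.sum_le_sum fun f hf => ?_).trans
      (Finset.sum_le_sum_of_subset_of_nonneg (Finset.subset_univ _) fun f _ _ => ?_)
    · rw [hprod, ← pow_mul]
      exact pow_le_pow_of_le_one hy0.le hy1.le (Finset.mem_filter.1 hf).2.le
    · rw [hprod]
      positivity
  have hsub : (Finset.univ.filter fun f : Fin k → Fin m =>
      ∃ r, A * (Finset.univ.filter fun a => f a = r).card < B * k) ⊆
      Finset.univ.biUnion fun r => Finset.univ.filter fun f : Fin k → Fin m =>
        A * (Finset.univ.filter fun a => f a = r).card < B * k := fun f hf => by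
    simpa using hf
  have h1 := (Finset.card_le_card hsub).trans Finset.card_biUnion_le
  refine (Nat.cast_le.2 h1).trans ?_
  rw [Nat.cast_sum]
  refine (Finset.sum_le_sum fun r _ => hone r).trans_eq ?_
  rw [Finset.sum_const, Finset.card_univ, Fintype.card_fin, nsmul_eq_mul]

section Circle

variable {k : ℕ} [NeZero k]

open Classical in
/-- The permutations with `n` peaks. -/
noncomputable def permsWithPeaks (k n : ℕ) [NeZero k] : Finset (Equiv.Perm (Fin k)) :=
  Finset.univ.filter fun σ => (peaks σ).ncard = n

open Classical in
/-- The permutations with `n` peaks in which some run has less than `B * k / A` values. -/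
noncomputable def permsWithShortRun (k n A B : ℕ) [NeZero k] : Finset (Equiv.Perm (Fin k)) :=
  Finset.univ.filter fun σ => (peaks σ).ncard = n ∧ ∃ r < 2 * n, A * runCard σ r < B * k

lemma card_permsWithShortRun_le (hk : 3 ≤ k) {n : ℕ} (hn : 1 ≤ n) (A B : ℕ) :
    (permsWithShortRun k n A B).card ≤ k * (Finset.univ.filter fun f : Fin k → Fin (2 * n) =>
        ∃ r, A * (Finset.univ.filter fun a => f a = r).card < B * k).card := by
  classical
  have hm : 0 < 2 * n := by omega
  -- Reduction modulo `2 * n` only makes the code total; it changes nothing when there are `n`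
  -- peaks.
  let code : Equiv.Perm (Fin k) → Fin k × (Fin k → Fin (2 * n)) := fun σ =>
    (bottom σ, fun a => ⟨valueRun σ a % (2 * n), Nat.mod_lt _ hm⟩)
  have hcode : ∀ σ ∈ permsWithShortRun k n A B, ∀ a, valueRun σ a % (2 * n) = valueRun σ a := by
    intro σ hσ a
    have h1 := (Finset.mem_filter.1 hσ).2.1
    have h2 := valueRun_lt (σ := σ) hk a
    rw [h1] at h2
    exact Nat.mod_eq_of_lt h2
  have hcard : ∀ s : Finset (Fin k → Fin (2 * n)),
      k * s.card = ((Finset.univ : Finset (Fin k)) ×ˢ s).card := fun s => by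
    rw [Finset.card_product, Finset.card_univ, Fintype.card_fin]
  rw [hcard]
  refine Finset.card_le_card_of_injOn code ?_ ?_
  · intro σ hσ
    obtain ⟨-, h1, r, hr, h2⟩ := Finset.mem_filter.1 hσ
    simp only [Finset.coe_product, Set.mem_prod, Finset.mem_coe, Finset.mem_univ,
      Finset.mem_filter, true_and]
    refine ⟨⟨r, hr⟩, lt_of_eq_of_lt ?_ h2⟩
    congr 2
    ext a
    simp only [Finset.mem_filter, Finset.mem_univ, true_and, Fin.ext_iff, code]
    rw [hcode σ hσ a]
  · intro σ hσ τ hτ h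
    have h1 : bottom σ = bottom τ := congrArg Prod.fst h
    refine eq_of_valueRun_eq hk h1 fun a => ?_
    have h2 := congrArg (fun c => (c.2 a).val) h
    simp only [code] at h2
    rwa [hcode σ hσ, hcode τ hτ] at h2

/-! ### Permutations with prescribed runs -/

lemma exists_perm_lt_iff {α : Type*} [LinearOrder α] {k : ℕ} (x : Fin k → α)
    (h : Function.Injective x) : ∃ σ : Equiv.Perm (Fin k), ∀ i j, σ i < σ j ↔ x i < x j := by
  have h1 := (Tuple.monotone_sort x).strictMono_of_injective (h.comp (Tuple.sort x).injective)
  refine ⟨(Tuple.sort x).symm, fun i j => ?_⟩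
  rw [← h1.lt_iff_lt]
  simp

/-- The assignment of values to `2 * n` runs such that the `n` smallest values are the beginnings
of the increasing runs and the `n` largest values are the beginnings of the decreasing runs. -/
structure IsRunMap (n : ℕ) (f : Fin k → ℕ) : Prop where
  low : ∀ a : Fin k, a.val < n → f a = 2 * a.val
  high : ∀ (a : Fin k) (v : ℕ), a.val = k - n + v → f a = 2 * v + 1
  lt : ∀ a, f a < 2 * n

/-- The order of positions of values for given runs. -/
def RunLT (f : Fin k → ℕ) (a b : Fin k) : Prop :=
  f a < f b ∨ f a = f b ∧ if Even (f a) then a < b else b < a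

omit [NeZero k] in
-- `RunLT` is lexicographic: run index first, then the value, with its sign reversed in decreasing
-- runs.
lemma exists_perm_runLT (f : Fin k → ℕ) :
    ∃ σ : Equiv.Perm (Fin k), ∀ a b, σ.symm a < σ.symm b ↔ RunLT f a b := by
  let key : Fin k → ℕ ×ₗ ℤ := fun a => toLex (f a, if Even (f a) then (a.val : ℤ) else -a.val)
  have hinj : Function.Injective key := fun a b h => by
    have h1 : f a = f b := congrArg (fun p => (ofLex p).1) h
    have h2 : (if Even (f a) then (a.val : ℤ) else -a.val) =
        if Even (f b) then (b.val : ℤ) else -b.val := congrArg (fun p => (ofLex p).2) h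
    rw [h1] at h2
    ext
    split_ifs at h2 <;> omega
  obtain ⟨σ, hσ⟩ := exists_perm_lt_iff key hinj
  refine ⟨σ.symm, fun a b => ?_⟩
  rw [Equiv.symm_symm, hσ, Prod.Lex.toLex_lt_toLex, RunLT]
  refine or_congr_right (and_congr_right fun h => ?_)
  simp only at h ⊢
  rw [h]
  split_ifs
  · rw [Nat.cast_lt, Fin.lt_def]
  · rw [neg_lt_neg_iff, Nat.cast_lt, Fin.lt_def]

omit [NeZero k] in
lemma adj_iff_val (hk : 3 ≤ k) (p x : Fin k) : (SimpleGraph.cycleGraph k).Adj p x ↔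
    x.val = p.val + 1 ∨ p.val = x.val + 1 ∨ (x.val = 0 ∧ p.val = k - 1) ∨
      (p.val = 0 ∧ x.val = k - 1) := by
  have hp := p.isLt
  have hx := x.isLt
  rw [SimpleGraph.cycleGraph_adj', Fin.val_sub, Fin.val_sub]
  have h1 : ∀ a b : ℕ, a < k → b < k → ((k - b + a) % k = 1 ↔ a = b + 1 ∨ (a = 0 ∧ b = k - 1)) := by
    intro a b ha hb
    rcases Nat.lt_or_ge a b with h | h
    · rw [Nat.mod_eq_of_lt (by omega)]
      omega
    · rw [show k - b + a = (a - b) + k by omega, Nat.add_mod_right, Nat.mod_eq_of_lt (by omega)]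
      omega
  rw [h1 _ _ hp hx, h1 _ _ hx hp]
  omega

/-- The peaks of the permutation with prescribed runs are the largest `n` values. -/
lemma peaks_eq_of_isRunMap (hk : 3 ≤ k) {n : ℕ} (hn : 1 ≤ n) (hkn : 2 * n ≤ k) {f : Fin k → ℕ}
    (hf : IsRunMap n f) {σ : Equiv.Perm (Fin k)}
    (hσ : ∀ a b, σ.symm a < σ.symm b ↔ RunLT f a b) :
    peaks σ = {p | k - n ≤ (σ p).val} := by
  have hpos : ∀ p q, p < q ↔ RunLT f (σ p) (σ q) := fun p q => by
    rw [← hσ, Equiv.symm_apply_apply, Equiv.symm_apply_apply]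
  have hnext : ∀ p q c, q.val = p.val + 1 → RunLT f (σ p) c → ¬ RunLT f c (σ q) := by
    intro p q c hpq h1 h2
    rw [← hσ, Equiv.symm_apply_apply] at h1 h2
    rw [Fin.lt_def] at h1 h2
    omega
  -- the first element of a decreasing run
  have htop : ∀ v < n, ∃ c : Fin k, c.val = k - n + v ∧ f c = 2 * v + 1 := fun v hv =>
    ⟨⟨k - n + v, by omega⟩, rfl, hf.high _ v rfl⟩
  have hzero : ∀ p : Fin k, p.val = 0 → (σ p).val = 0 := fun p hp => by
    by_contra h0
    have h1 : RunLT f 0 (σ p) := by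
      have h2 : f 0 = 0 := hf.low 0 (by simp only [Fin.val_zero]; omega)
      rw [RunLT, h2]
      rcases Nat.eq_zero_or_pos (f (σ p)) with h3 | h3
      · refine Or.inr ⟨h3.symm, ?_⟩
        rw [if_pos (by simp), Fin.lt_def]
        simpa using Nat.pos_of_ne_zero h0
      · exact Or.inl h3
    rw [← hσ, Equiv.symm_apply_apply, Fin.lt_def] at h1
    omega
  -- Two of the top `n` values begin different decreasing runs, and the prescribed beginning of an
  -- increasing run lies between them.
  have hconsec : ∀ p q : Fin k, q.val = p.val + 1 → k - n ≤ (σ p).val → k - n ≤ (σ q).val →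
      False := by
    intro p q hpq h1 h2
    have hp := (σ p).isLt
    have hq := (σ q).isLt
    have e1 := hf.high (σ p) ((σ p).val - (k - n)) (by omega)
    have e2 := hf.high (σ q) ((σ q).val - (k - n)) (by omega)
    have hlt : RunLT f (σ p) (σ q) := (hpos p q).1 (by rw [Fin.lt_def]; omega)
    have hlt' : f (σ p) < f (σ q) := by
      rcases hlt with h | ⟨h, h'⟩
      · exact h
      · have : σ p = σ q := by
          ext
          omega
        rw [this] at h'
        split_ifs at h' <;> exact absurd h' (lt_irrefl _)
    let c : Fin k := ⟨(σ p).val - (k - n) + 1, by omega⟩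
    have hc : f c = 2 * ((σ p).val - (k - n) + 1) := hf.low c (by
      change (σ p).val - (k - n) + 1 < n
      omega)
    exact hnext p q c hpq (Or.inl (by omega)) (Or.inl (by omega))
  ext p
  rw [Set.mem_ofPred_eq]
  constructor
  · intro hp
    by_contra hlow
    have hlow : (σ p).val < k - n := not_le.1 hlow
    have hlt := hf.lt (σ p)
    -- In an increasing run the right neighbour is larger: it is in the same run or begins the next.
    -- In a decreasing run, which begins with a top value, the left neighbour is larger.
    rcases Nat.even_or_odd' (f (σ p)) with ⟨v, hv | hv⟩
    · obtain ⟨c, hc, hfc⟩ := htop v (by omega)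
      have h1 : RunLT f (σ p) c := Or.inl (by omega)
      have h2 : p.val < (σ.symm c).val := by
        have := (hσ (σ p) c).2 h1
        rwa [Equiv.symm_apply_apply, Fin.lt_def] at this
      have hq : p.val + 1 < k := by have := (σ.symm c).isLt; omega
      set q : Fin k := ⟨p.val + 1, hq⟩ with hqdef
      have h3 : ¬ RunLT f c (σ q) := hnext p q c rfl h1
      have h4 : RunLT f (σ p) (σ q) := (hpos p q).1 (by rw [Fin.lt_def]; simp [hqdef])
      have h5 := hp q ((adj_iff_val hk p q).2 (Or.inl rfl))
      rw [Fin.lt_def] at h5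
      simp only [RunLT, hv, hfc, even_two_mul, if_true, not_or, not_and] at h3 h4
      rcases h4 with h4 | ⟨-, h4⟩
      · have h6 := h3.2 (by omega)
        rw [if_neg (by simp), Fin.lt_def] at h6
        omega
      · rw [Fin.lt_def] at h4
        omega
    · obtain ⟨c, hc, hfc⟩ := htop v (by omega)
      have hodd : ¬ Even (2 * v + 1) := by simp
      have h1 : RunLT f c (σ p) := Or.inr ⟨by omega, by
        rw [hfc, if_neg hodd, Fin.lt_def]
        omega⟩
      have h2 : (σ.symm c).val < p.val := by
        have := (hσ c (σ p)).2 h1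
        rwa [Equiv.symm_apply_apply, Fin.lt_def] at this
      have hp' := p.isLt
      set q : Fin k := ⟨p.val - 1, by omega⟩ with hqdef
      have hqp : p.val = q.val + 1 := by
        change p.val = p.val - 1 + 1
        omega
      have h3 : ¬ RunLT f (σ q) c := fun h => hnext q p c hqp h h1
      have h4 : RunLT f (σ q) (σ p) := (hpos q p).1 (by rw [Fin.lt_def]; omega)
      have h5 := hp q ((adj_iff_val hk p q).2 (Or.inr (Or.inl hqp)))
      rw [Fin.lt_def] at h5
      simp only [RunLT, hv, hfc, not_or, not_and] at h3 h4
      rcases h4 with h4 | ⟨h4, h6⟩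
      · exact h3.1 h4
      · rw [h4, if_neg hodd, Fin.lt_def] at h6
        omega
  · intro hp x hx
    rw [Fin.lt_def]
    have hx' : (σ x).val < k - n := by
      by_contra h
      rcases (adj_iff_val hk p x).1 hx with h1 | h1 | h1 | h1
      · exact hconsec p x h1 hp (not_lt.1 h)
      · exact hconsec x p h1 (not_lt.1 h) hp
      · have := hzero x h1.1
        omega
      · have := hzero p h1.1
        omega
    omega

lemma ncard_peaks_of_isRunMap (hk : 3 ≤ k) {n : ℕ} (hn : 1 ≤ n) (hkn : 2 * n ≤ k)
    {f : Fin k → ℕ} (hf : IsRunMap n f) {σ : Equiv.Perm (Fin k)}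
    (hσ : ∀ a b, σ.symm a < σ.symm b ↔ RunLT f a b) : (peaks σ).ncard = n := by
  rw [peaks_eq_of_isRunMap hk hn hkn hf hσ]
  have h1 : {p | k - n ≤ (σ p).val} = σ.symm '' {a : Fin k | k - n ≤ a.val} := by
    ext p
    constructor
    · intro hp
      exact ⟨σ p, hp, σ.symm_apply_apply p⟩
    · rintro ⟨a, ha, rfl⟩
      rw [Set.mem_ofPred_eq, Equiv.apply_symm_apply]
      exact ha
  rw [h1, Set.ncard_image_of_injective _ σ.symm.injective]
  have h2 : {a : Fin k | k - n ≤ a.val} =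
      ((Finset.univ.filter fun a : Fin k => k - n ≤ a.val : Finset (Fin k)) : Set (Fin k)) := by
    ext a
    simp
  rw [h2, Set.ncard_coe_finset]
  have h3 := Finset.card_filter_add_card_filter_not (s := (Finset.univ : Finset (Fin k)))
    (fun a : Fin k => a.val < k - n)
  rw [Fin.card_filter_val_lt, Finset.card_univ, Fintype.card_fin] at h3
  simp only [not_lt] at h3
  omega

omit [NeZero k] in
-- The prescribed beginnings are markers. If `f a < g a`, then `f` places `a` before the marker of
-- run `g a`, which `g` does not unless `a` is a prescribed value, where `f` and `g` agree.
lemma IsRunMap.eq_of_runLT_iff {n : ℕ} (hkn : 2 * n ≤ k) {f g : Fin k → ℕ} (hf : IsRunMap n f)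
    (hg : IsRunMap n g) (h : ∀ a b, RunLT f a b ↔ RunLT g a b) : f = g := by
  have key : ∀ f g : Fin k → ℕ, IsRunMap n f → IsRunMap n g →
      (∀ a b, RunLT f a b ↔ RunLT g a b) → ∀ a, ¬ f a < g a := by
    intro f g hf hg h a hlt
    have ha := a.isLt
    have hga := hg.lt a
    rcases Nat.even_or_odd' (g a) with ⟨v, hv | hv⟩
    · let c : Fin k := ⟨v, by omega⟩
      have hcv : c.val = v := rfl
      have h1 : f c = 2 * v := hf.low c (by omega)
      have h2 : g c = 2 * v := hg.low c (by omega)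
      have h3 := (h a c).1 (Or.inl (by omega))
      simp only [RunLT, hv, h2, lt_irrefl, false_or, true_and, even_two_mul, if_true,
        Fin.lt_def] at h3
      have h4 := hf.low a (by omega)
      have h5 := hg.low a (by omega)
      omega
    · let c : Fin k := ⟨k - n + v, by omega⟩
      have hcv : c.val = k - n + v := rfl
      have h1 : f c = 2 * v + 1 := hf.high c v rfl
      have h2 : g c = 2 * v + 1 := hg.high c v rfl
      have h3 := (h a c).1 (Or.inl (by omega))
      have hodd : ¬ Even (2 * v + 1) := by simp
      simp only [RunLT, hv, h2, lt_irrefl, false_or, true_and, if_neg hodd, Fin.lt_def] at h3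
      have h4 := hf.high a (a.val - (k - n)) (by omega)
      have h5 := hg.high a (a.val - (k - n)) (by omega)
      omega
  ext a
  have h1 := key f g hf hg h a
  have h2 := key g f hg hf (fun a b => (h a b).symm) a
  omega

/-- The assignment of values to runs with given runs of the middle values. -/
def extendRunMap (n : ℕ) (g : Fin (k - 2 * n) → Fin (2 * n)) (a : Fin k) : ℕ :=
  if a.val < n then 2 * a.val
  else if h : a.val - n < k - 2 * n then (g ⟨a.val - n, h⟩).val
  else 2 * (a.val - (k - n)) + 1

omit [NeZero k] in
lemma isRunMap_extendRunMap {n : ℕ} (hkn : 2 * n ≤ k) (g : Fin (k - 2 * n) → Fin (2 * n)) :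
    IsRunMap n (extendRunMap (k := k) n g) where
  low a ha := if_pos ha
  high a v hv := by
    rw [extendRunMap, if_neg (by omega), dif_neg (by omega)]
    omega
  lt a := by
    have := a.isLt
    rw [extendRunMap]
    split_ifs
    · omega
    · exact (g _).isLt
    · omega

/-- Each of the `k - 2 * n` middle values chooses its run freely. -/
lemma card_permsWithPeaks_ge (hk : 3 ≤ k) {n : ℕ} (hn : 1 ≤ n) (hkn : 2 * n ≤ k) :
    (2 * n) ^ (k - 2 * n) ≤ (permsWithPeaks k n).card := by
  classical
  choose perm hperm using fun g : Fin (k - 2 * n) → Fin (2 * n) =>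
    exists_perm_runLT (extendRunMap (k := k) n g)
  have h1 : Fintype.card (Fin (k - 2 * n) → Fin (2 * n)) = (2 * n) ^ (k - 2 * n) := by simp
  rw [← h1, ← Finset.card_univ]
  refine Finset.card_le_card_of_injOn perm ?_ ?_
  · intro g _
    simp only [permsWithPeaks, Finset.coe_filter, Finset.mem_univ, true_and, Set.mem_ofPred_eq]
    exact ncard_peaks_of_isRunMap hk hn hkn (isRunMap_extendRunMap hkn g) (hperm g)
  · intro g _ g' _ h
    have h2 := (isRunMap_extendRunMap hkn g).eq_of_runLT_iff hkn (isRunMap_extendRunMap hkn g')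
      fun a b => by rw [← hperm, ← hperm, h]
    ext i
    have hi := i.isLt
    have h3 := congrFun h2 (⟨i.val + n, by omega⟩ : Fin k)
    simp only [extendRunMap] at h3
    rw [if_neg (by omega), if_neg (by omega), dif_pos (by omega), dif_pos (by omega)] at h3
    simpa using h3

end Circle

/-! ### Most permutations with a given number of peaks have runs of similar length -/

/-- The ratio of the two counts is at most a constant depending on `n` times `k * ρ ^ k`, which
tends to 0. -/
lemma exists_card_permsWithShortRun_lt {n A B : ℕ} (hn : 1 ≤ n) (hAB : 2 * n * B < A) {ε : ℝ}
    (hε : 0 < ε) : ∃ K : ℕ, ∀ k : ℕ, K ≤ k → 3 ≤ k → ∀ _ : NeZero k,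
      ((permsWithShortRun k n A B).card : ℝ) < ε * (permsWithPeaks k n).card := by
  obtain ⟨ρ, hρ0, hρ1, hρ⟩ := exists_card_small_fiber_le hAB
  have hm : 0 < ((2 * n : ℕ) : ℝ) := by exact_mod_cast (by omega : 0 < 2 * n)
  have hlim := (tendsto_self_mul_const_pow_of_lt_one hρ0 hρ1).mul_const
    (((2 * n : ℕ) : ℝ) * ((2 * n : ℕ) : ℝ) ^ (2 * n))
  rw [zero_mul] at hlim
  obtain ⟨K, hK⟩ := eventually_atTop.1 (hlim.eventually (gt_mem_nhds hε))
  refine ⟨max K (2 * n), fun k hk hk3 _ => ?_⟩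
  have hkn : 2 * n ≤ k := (le_max_right _ _).trans hk
  have h1 : ((permsWithShortRun k n A B).card : ℝ) ≤
      k * (((2 * n : ℕ) : ℝ) * (ρ * ((2 * n : ℕ) : ℝ)) ^ k) := by
    refine (Nat.cast_le.2 (card_permsWithShortRun_le hk3 hn A B)).trans ?_
    rw [Nat.cast_mul]
    exact mul_le_mul_of_nonneg_left (hρ k) (Nat.cast_nonneg k)
  have h2 : ((2 * n : ℕ) : ℝ) ^ (k - 2 * n) ≤ (permsWithPeaks k n).card := by
    exact_mod_cast card_permsWithPeaks_ge hk3 hn hkn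
  have hpow : ((2 * n : ℕ) : ℝ) ^ k = ((2 * n : ℕ) : ℝ) ^ (2 * n) * ((2 * n : ℕ) : ℝ) ^ (k - 2 * n) := by
    rw [← pow_add, Nat.add_sub_cancel' hkn]
  calc ((permsWithShortRun k n A B).card : ℝ)
      ≤ k * (((2 * n : ℕ) : ℝ) * (ρ * ((2 * n : ℕ) : ℝ)) ^ k) := h1
    _ = (k * ρ ^ k * (((2 * n : ℕ) : ℝ) * ((2 * n : ℕ) : ℝ) ^ (2 * n))) *
          ((2 * n : ℕ) : ℝ) ^ (k - 2 * n) := by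
        rw [mul_pow, hpow]
        ring
    _ < ε * ((2 * n : ℕ) : ℝ) ^ (k - 2 * n) :=
        mul_lt_mul_of_pos_right (hK k ((le_max_left _ _).trans hk)) (by positivity)
    _ ≤ ε * (permsWithPeaks k n).card := by gcongr

lemma gapRatio_le {k : ℕ} {P : Set (Fin k × Fin k)} {a b r : ℝ} (ha : 0 < a) (hr : 0 ≤ r)
    (hab : b ≤ r * a) (h : ∀ p ∈ P, a ≤ arcLength p.1 p.2 ∧ (arcLength p.1 p.2 : ℝ) ≤ b) :
    gapRatio P ≤ r := by
  rw [gapRatio]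
  rcases P.eq_empty_or_nonempty with rfl | hne
  -- For an empty family the ratio is `0 / 0 = 0`.
  · simpa using hr
  have hne' := hne.image fun p => arcLength p.1 p.2
  obtain ⟨p, hp, hpe⟩ := Nat.sInf_mem hne'
  obtain ⟨q, hq, hqe⟩ := Nat.sSup_mem hne' ((Set.toFinite _).bddAbove)
  rw [← hpe, ← hqe]
  have h1 := (h p hp).1
  have h2 := (h q hq).2
  rw [div_le_iff₀ (ha.trans_le h1)]
  exact h2.trans (hab.trans (mul_le_mul_of_nonneg_left h1 hr))

section Circle

variable {k : ℕ} [NeZero k] {σ : Equiv.Perm (Fin k)} {n : ℕ}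

/-- If all runs are long, then the distances between consecutive extrema are similar. -/
lemma arcLength_bounds (hk : 3 ≤ k) (hn : (peaks σ).ncard = n)
    (hlong : ∀ r < 2 * n, (8 * n - 1) * k ≤ 16 * n ^ 2 * runCard σ r) {p : Fin k × Fin k}
    (hp : p ∈ adjacentMixedPairs (peaks σ) (valleys σ)) :
    ((8 * n - 1) * k - 16 * n ^ 2 : ℝ) ≤ 16 * n ^ 2 * arcLength p.1 p.2 ∧
      (16 * n ^ 2 * arcLength p.1 p.2 : ℝ) ≤ (10 * n - 1) * k + 16 * n ^ 2 := by
  obtain ⟨r, hr, h1, h2⟩ := exists_runCard_of_mixedPair hk hp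
  rw [hn] at hr
  have hn1 : 1 ≤ n := by omega
  have hlong' : ∀ r < 2 * n, ((8 * n - 1) * k : ℝ) ≤ 16 * n ^ 2 * runCard σ r := fun r hr => by
    have := hlong r hr
    have h3 : (((8 * n - 1) * k : ℕ) : ℝ) ≤ ((16 * n ^ 2 * runCard σ r : ℕ) : ℝ) := by
      exact_mod_cast this
    rw [Nat.cast_mul, Nat.cast_sub (by omega)] at h3
    push_cast at h3
    exact h3
  have hsum := sum_runCard (σ := σ) hk (m := 2 * n) (by omega)
  rw [← Finset.add_sum_erase _ _ (Finset.mem_range.2 hr)] at hsum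
  have hsum' : (runCard σ r : ℝ) + ∑ x ∈ (Finset.range (2 * n)).erase r, (runCard σ x : ℝ) = k := by
    exact_mod_cast hsum
  -- What the other `2 * n - 1` runs must use bounds run `r` from above: `16 * n ^ 2 - (2 * n - 1) *
  -- (8 * n - 1) = 10 * n - 1`.
  have hrest : ((2 * n - 1) * ((8 * n - 1) * k) : ℝ) ≤
      16 * n ^ 2 * ∑ x ∈ (Finset.range (2 * n)).erase r, (runCard σ x : ℝ) := by
    rw [Finset.mul_sum]
    have h3 := Finset.card_nsmul_le_sum ((Finset.range (2 * n)).erase r)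
      (fun x => (16 * n ^ 2 * runCard σ x : ℝ)) ((8 * n - 1) * k : ℝ) fun x hx =>
        hlong' x (Finset.mem_range.1 (Finset.mem_of_mem_erase hx))
    rw [Finset.card_erase_of_mem (Finset.mem_range.2 hr), Finset.card_range, nsmul_eq_mul,
      Nat.cast_sub (by omega)] at h3
    push_cast at h3
    exact h3
  have h1' : (runCard σ r : ℝ) ≤ arcLength p.1 p.2 + 1 := by exact_mod_cast h1
  have h2' : (arcLength p.1 p.2 : ℝ) ≤ runCard σ r + 1 := by exact_mod_cast h2
  have hn2 : 0 < (16 * n ^ 2 : ℝ) := by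
    have : (1 : ℝ) ≤ n := by exact_mod_cast hn1
    positivity
  constructor
  · have h3 := hlong' r hr
    have h4 := mul_le_mul_of_nonneg_left h1' hn2.le
    linarith
  · have h4 := mul_le_mul_of_nonneg_left h2' hn2.le
    have h5 : (16 * n ^ 2 * runCard σ r : ℝ) =
        16 * n ^ 2 * k - 16 * n ^ 2 * ∑ x ∈ (Finset.range (2 * n)).erase r, (runCard σ x : ℝ) := by
      rw [← hsum']
      ring
    nlinarith

lemma gapRatio_mixedPairs_le (hk : 3 ≤ k) (hn1 : 1 ≤ n) (hkn : 48 * n ^ 2 ≤ k)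
    (hn : (peaks σ).ncard = n)
    (hlong : ∀ r < 2 * n, (8 * n - 1) * k ≤ 16 * n ^ 2 * runCard σ r) :
    gapRatio (adjacentMixedPairs (peaks σ) (valleys σ)) ≤ 2 ∧
      gapRatio (adjacentPairs (peaks σ)) ≤ 2 := by
  have hn1' : (1 : ℝ) ≤ n := by exact_mod_cast hn1
  have hkn' : (48 * n ^ 2 : ℝ) ≤ k := by exact_mod_cast hkn
  have hn2 : 0 < (16 * n ^ 2 : ℝ) := by positivity
  set a : ℝ := ((8 * n - 1) * k - 16 * n ^ 2) / (16 * n ^ 2) with ha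
  set b : ℝ := ((10 * n - 1) * k + 16 * n ^ 2) / (16 * n ^ 2) with hb
  have hbound : ∀ p ∈ adjacentMixedPairs (peaks σ) (valleys σ),
      a ≤ arcLength p.1 p.2 ∧ (arcLength p.1 p.2 : ℝ) ≤ b := fun p hp => by
    have := arcLength_bounds hk hn hlong hp
    rw [ha, hb, div_le_iff₀ hn2, le_div_iff₀ hn2]
    constructor <;> linarith [this.1, this.2]
  have hkpos : (0 : ℝ) < k := by linarith
  have hapos : 0 < a := by
    refine div_pos ?_ hn2
    nlinarith
  -- This amounts to `48 * n ^ 2 ≤ (6 * n - 1) * k`.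
  have hab : b ≤ 2 * a := by
    rw [ha, hb, ← mul_div_assoc, div_le_div_iff_of_pos_right hn2]
    nlinarith
  refine ⟨gapRatio_le hapos zero_le_two hab hbound,
    gapRatio_le (a := 2 * a) (b := 2 * b) (by linarith) zero_le_two (by linarith) fun p hp => ?_⟩
  obtain ⟨x, h1, h2, h3⟩ := exists_valley_between hk hp
  have h3' : (arcLength p.1 x + arcLength x p.2 : ℝ) = arcLength p.1 p.2 := by exact_mod_cast h3
  have h4 := hbound _ h1
  have h5 := hbound _ h2
  simp only at h4 h5
  constructor <;> linarith [h4.1, h4.2, h5.1, h5.2]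

end Circle

/-! ### Conditional probabilities -/

lemma cond_real_gt {Ω ι : Type*} [MeasurableSpace Ω] {μ : Measure Ω} [IsProbabilityMeasure μ]
    {E : ι → Set Ω} (hE : ∀ i, MeasurableSet (E i)) (hdisj : Pairwise fun i j => Disjoint (E i) (E j))
    {q : ENNReal} (hq : ∀ i, μ (E i) = q) (hq0 : q ≠ 0) {S G : Finset ι} {H A : Set Ω}
    (hH : H =ᵐ[μ] ⋃ i ∈ S, E i) (hA : ∀ᵐ ω ∂μ, ω ∈ ⋃ i ∈ G, E i → ω ∈ A ∧ ω ∈ H) {p : ℝ}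
    (hS : 0 < S.card) (hp : p * S.card < G.card) : 0 < μ H ∧ p < (cond μ H).real A := by
  have hmeas : ∀ T : Finset ι, μ (⋃ i ∈ T, E i) = T.card * q := fun T => by
    rw [measure_biUnion_finset (fun i _ j _ hij => hdisj hij) fun i _ => hE i]
    simp [hq]
  have hμH : μ H = S.card * q := (measure_congr hH).trans (hmeas S)
  have hqtop : q ≠ ⊤ := by
    obtain ⟨i, -⟩ := Finset.card_pos.1 hS
    exact hq i ▸ measure_ne_top μ _
  -- Null-measurability of `H` suffices to compute the conditional measure of `A`, whose
  -- measurability is not known.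
  have hHnull : NullMeasurableSet H μ :=
    (S.measurableSet_biUnion fun i _ => hE i).nullMeasurableSet.congr hH.symm
  have hHpos : μ H ≠ 0 := by
    rw [hμH]
    exact mul_ne_zero (by exact_mod_cast hS.ne') hq0
  refine ⟨pos_iff_ne_zero.2 hHpos, ?_⟩
  have hAH : (G.card : ENNReal) * q ≤ μ (A ∩ H) := by
    rw [← hmeas G]
    exact measure_mono_ae hA
  have hcond : (cond μ H).real A = (μ (A ∩ H)).toReal / (μ H).toReal := by
    rw [Measure.real, ProbabilityTheory.cond, Measure.smul_apply, Measure.restrict_apply₀' hHnull, smul_eq_mul,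
      ENNReal.toReal_mul, ENNReal.toReal_inv, div_eq_inv_mul]
  have hq' : 0 < q.toReal := ENNReal.toReal_pos hq0 hqtop
  have hS' : (0 : ℝ) < S.card := by exact_mod_cast hS
  rw [hcond, hμH, ENNReal.toReal_mul, ENNReal.toReal_natCast, lt_div_iff₀ (by positivity)]
  calc p * (S.card * q.toReal) = p * S.card * q.toReal := by ring
    _ < G.card * q.toReal := mul_lt_mul_of_pos_right hp hq'
    _ = (G.card * q).toReal := by rw [ENNReal.toReal_mul, ENNReal.toReal_natCast]
    _ ≤ (μ (A ∩ H)).toReal := ENNReal.toReal_mono (measure_ne_top μ _) hAH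

/-! ### Craters and mounds of the stationary meteor process on the circle -/

section MeteorOnCircle

variable {k : ℕ} [NeZero k] {Ω : Type*} [MeasurableSpace Ω] {μ : Measure Ω}
  [IsProbabilityMeasure μ] {N : Fin k → ℝ → Ω → ℤ} {M : ℝ → Ω → Fin k → ℝ}

/-- The event that the last hits of sites up to time `0` are ordered like the values of `σ`. -/
def lastJumpOrder (N : Fin k → ℝ → Ω → ℤ) (σ : Equiv.Perm (Fin k)) : Set Ω :=
  orderEvent (fun v ω => ratLastJump fun t => N v t ω) σ

lemma IsStationaryMeteorProcess.ae_craters_mounds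
    (h : IsStationaryMeteorProcess (SimpleGraph.cycleGraph k) μ N M) :
    ∀ᵐ ω ∂μ, (∃ σ, ω ∈ lastJumpOrder N σ) ∧ ∀ σ, ω ∈ lastJumpOrder N σ →
      cratersAtZero M ω = peaks σ ∧ moundsAtZero N ω = valleys σ := by
  have hG : (SimpleGraph.cycleGraph k).Connected := by
    obtain ⟨j, rfl⟩ : ∃ j, k = j + 1 := ⟨k - 1, by have := NeZero.pos k; omega⟩
    exact SimpleGraph.cycleGraph_connected
  filter_upwards [h.ae_craters_eq hG, h.ae_injective_ratLastJump,
    ae_all_iff.2 fun v => (h.poisson v).ae_ratLastJump] with ω h1 h2 h3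
  refine ⟨exists_mem_orderEvent h2, fun σ hσ => ?_⟩
  have hord : ∀ i j, lastJump (fun t => N i t ω) < lastJump (fun t => N j t ω) ↔ σ i < σ j :=
    fun i j => by
      rw [← (h3 i).1, ← (h3 j).1]
      exact hσ i j
  constructor
  · rw [cratersAtZero, h1]
    simp only [hord]
    rfl
  · rw [moundsAtZero, mounds]
    simp only [hord]
    rfl

/-- A criterion for events that depend only on the order of the last hits of sites. -/
lemma IsStationaryMeteorProcess.cond_real_gt
    (h : IsStationaryMeteorProcess (SimpleGraph.cycleGraph k) μ N M) (hk : 3 ≤ k) {n : ℕ}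
    (hn : 1 ≤ n) (hkn : 48 * n ^ 2 ≤ k) {p : ℝ}
    (hcard : ((permsWithShortRun k n (16 * n ^ 2) (8 * n - 1)).card : ℝ) <
      (1 - p) * (permsWithPeaks k n).card) {H A : Set Ω}
    (hH : ∀ ω σ, cratersAtZero M ω = peaks σ → moundsAtZero N ω = valleys σ →
      (ω ∈ H ↔ (peaks σ).ncard = n))
    (hA : ∀ ω σ, cratersAtZero M ω = peaks σ → moundsAtZero N ω = valleys σ →
      gapRatio (adjacentMixedPairs (peaks σ) (valleys σ)) ≤ 2 →
      gapRatio (adjacentPairs (peaks σ)) ≤ 2 → ω ∈ A) :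
    0 < μ H ∧ p < (cond μ H).real A := by
  classical
  have hX : ∀ v, Measurable fun ω => ratLastJump fun t => N v t ω := fun v =>
    (h.poisson v).measurable_ratLastJump
  have hind : iIndepFun (fun v ω => ratLastJump fun t => N v t ω) μ :=
    h.indep.comp (fun _ => ratLastJump) fun _ => measurable_ratLastJump
  have hlaw : ∀ v w, μ.map (fun ω => ratLastJump fun t => N v t ω) =
      μ.map fun ω => ratLastJump fun t => N w t ω := fun v w => by
    have : IsProbabilityMeasure (μ.map fun ω => ratLastJump fun t => N v t ω) :=
      Measure.isProbabilityMeasure_map (hX v).aemeasurable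
    refine Measure.ext_of_Iic _ _ fun a => ?_
    rw [Measure.map_apply (hX v) measurableSet_Iic, Measure.map_apply (hX w) measurableSet_Iic]
    exact ((h.poisson v).measure_ratLastJump_le a).trans
      ((h.poisson w).measure_ratLastJump_le a).symm
  have hsub : permsWithShortRun k n (16 * n ^ 2) (8 * n - 1) ⊆ permsWithPeaks k n := fun σ hσ =>
    Finset.mem_filter.2 ⟨Finset.mem_univ _, (Finset.mem_filter.1 hσ).2.1⟩
  have hcardG := Finset.card_sdiff_add_card_eq_card hsub
  have hcardG' : ((permsWithPeaks k n \ permsWithShortRun k n (16 * n ^ 2) (8 * n - 1)).card : ℝ) +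
      (permsWithShortRun k n (16 * n ^ 2) (8 * n - 1)).card = (permsWithPeaks k n).card := by
    exact_mod_cast hcardG
  have hpos : 0 < (permsWithPeaks k n).card := by
    refine lt_of_lt_of_le ?_ (card_permsWithPeaks_ge hk hn (by nlinarith))
    exact Nat.pow_pos (by omega)
  refine Meteor.cond_real_gt (E := lastJumpOrder N) (q := μ (lastJumpOrder N 1))
    (S := permsWithPeaks k n)
    (G := permsWithPeaks k n \ permsWithShortRun k n (16 * n ^ 2) (8 * n - 1))
    (fun σ => measurableSet_orderEvent hX σ) (fun σ τ hστ => disjoint_orderEvent hστ)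
    (fun σ => measure_orderEvent_eq hX hind hlaw σ)
    (measure_orderEvent_ne_zero hX hind hlaw h.ae_injective_ratLastJump) ?_ ?_ hpos
    (by linarith)
  · filter_upwards [h.ae_craters_mounds] with ω hω
    refine propext ?_
    change ω ∈ H ↔ ω ∈ ⋃ σ ∈ permsWithPeaks k n, lastJumpOrder N σ
    simp only [Set.mem_iUnion, exists_prop]
    constructor
    · intro hωH
      obtain ⟨σ, hσ⟩ := hω.1
      have := hω.2 σ hσ
      exact ⟨σ, Finset.mem_filter.2 ⟨Finset.mem_univ _, (hH ω σ this.1 this.2).1 hωH⟩, hσ⟩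
    · rintro ⟨σ, hσS, hσ⟩
      have := hω.2 σ hσ
      exact (hH ω σ this.1 this.2).2 (Finset.mem_filter.1 hσS).2
  · filter_upwards [h.ae_craters_mounds] with ω hω hmem
    simp only [Set.mem_iUnion, exists_prop] at hmem
    obtain ⟨σ, hσG, hσ⟩ := hmem
    obtain ⟨h1, h2⟩ := Finset.mem_sdiff.1 hσG
    have h3 := (Finset.mem_filter.1 h1).2
    obtain ⟨h4, h5⟩ := hω.2 σ hσ
    have hlong : ∀ r < 2 * n, (8 * n - 1) * k ≤ 16 * n ^ 2 * runCard σ r := fun r hr => by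
      by_contra hlt
      exact h2 (Finset.mem_filter.2 ⟨Finset.mem_univ _, h3, r, hr, not_le.1 hlt⟩)
    obtain ⟨h6, h7⟩ := gapRatio_mixedPairs_le hk hn hkn h3 hlong
    exact ⟨hA ω σ h4 h5 h6 h7, (hH ω σ h4 h5).2 h3⟩

end MeteorOnCircle

/-- The threshold `(8 * n - 1) / (16 * n ^ 2)` is `1 / (2 * n)` reduced by the factor `1 - 1 / (8 *
n)`: below the mean, yet close enough for the factor 2. -/
lemma exists_card_bound {n : ℕ} (hn : 1 ≤ n) {p : ℝ} (hp : p < 1) :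
    ∃ K : ℕ, ∀ k : ℕ, K ≤ k → 3 ≤ k → ∀ _ : NeZero k, 48 * n ^ 2 ≤ k ∧
      ((permsWithShortRun k n (16 * n ^ 2) (8 * n - 1)).card : ℝ) <
        (1 - p) * (permsWithPeaks k n).card := by
  have hAB : 2 * n * (8 * n - 1) < 16 * n ^ 2 := by
    have h1 : 2 * n * (8 * n - 1) < 2 * n * (8 * n) :=
      Nat.mul_lt_mul_of_pos_left (by omega) (by omega)
    nlinarith
  obtain ⟨K, hK⟩ := exists_card_permsWithShortRun_lt hn hAB (sub_pos.2 hp)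
  exact ⟨max K (48 * n ^ 2), fun k hk hk3 hk0 =>
    ⟨(le_max_right _ _).trans hk, hK k ((le_max_left _ _).trans hk) hk3 hk0⟩⟩

end Meteor

theorem theorem4p6 :
    (∀ n : ℕ, 2 ≤ n → ∀ p : ℝ, p < 1 → ∀ r : ℝ, 2 < r →
      ∃ k₁ : ℕ, ∀ k : ℕ, k₁ ≤ k → 3 ≤ k →
        ∀ (Ω : Type*) [MeasurableSpace Ω] (μ : Measure Ω) [IsProbabilityMeasure μ]
          (N : Fin k → ℝ → Ω → ℤ) (M : ℝ → Ω → Fin k → ℝ),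
          Meteor.IsStationaryMeteorProcess (SimpleGraph.cycleGraph k) μ N M →
            0 < μ (Meteor.eventH1 M n) ∧
              p < (ProbabilityTheory.cond μ (Meteor.eventH1 M n)).real (Meteor.eventA1 M r)) ∧
    (∀ n : ℕ, 2 ≤ n → Even n → ∀ p : ℝ, p < 1 → ∀ r : ℝ, 2 < r →
      ∃ k₁ : ℕ, ∀ k : ℕ, k₁ ≤ k → 3 ≤ k →
        ∀ (Ω : Type*) [MeasurableSpace Ω] (μ : Measure Ω) [IsProbabilityMeasure μ]
          (N : Fin k → ℝ → Ω → ℤ) (M : ℝ → Ω → Fin k → ℝ),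
          Meteor.IsStationaryMeteorProcess (SimpleGraph.cycleGraph k) μ N M →
            0 < μ (Meteor.eventH2 N M n) ∧
              p < (ProbabilityTheory.cond μ (Meteor.eventH2 N M n)).real
                (Meteor.eventA2 N M r)) := by
  refine ⟨fun n hn p hp r hr => ?_, fun n hn he p hp r hr => ?_⟩
  · obtain ⟨K, hK⟩ := Meteor.exists_card_bound (show 1 ≤ n by omega) hp
    refine ⟨K, fun k hk hk3 Ω _ μ _ N M h => ?_⟩
    have hk0 : NeZero k := ⟨by omega⟩
    obtain ⟨hkn, hcard⟩ := hK k hk hk3 hk0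
    refine h.cond_real_gt hk3 (by omega) hkn hcard (fun ω σ h1 _ => ?_) fun ω σ h1 _ _ h4 => ?_
    · rw [← h1]
      exact Iff.rfl
    · rw [← h1] at h4
      exact h4.trans hr.le
  -- Peaks and valleys alternate, so `2 * m` extrema in total mean `m` peaks.
  · obtain ⟨m, rfl⟩ := he.two_dvd
    obtain ⟨K, hK⟩ := Meteor.exists_card_bound (show 1 ≤ m by omega) hp
    refine ⟨K, fun k hk hk3 Ω _ μ _ N M h => ?_⟩
    have hk0 : NeZero k := ⟨by omega⟩
    obtain ⟨hkn, hcard⟩ := hK k hk hk3 hk0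
    refine h.cond_real_gt hk3 (by omega) hkn hcard (fun ω σ h1 h2 => ?_) fun ω σ h1 h2 h3 _ => ?_
    · have h4 := Meteor.ncard_extrema_eq (σ := σ) hk3
      rw [← h1, ← h2] at h4
      rw [← h1]
      change (_ = _) ↔ _
      omega
    · rw [← h1, ← h2] at h3
      exact h3.trans hr.le
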